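/- Let $\mathcal P_1$ be the set of all $h\in L^\infty(0,1)$ that are non-negative, concave, and satisfy $\int_0^1 h\,dx=1$; each such $h$ is identified with its concave representative on $(0,1)$. For $h\in\mathcal P_1$ put $$\mu_1(h)=\inf_{\substack{u\in H^1(0,1)\setminus\{0\}\\ \int_0^1 uh\,dx=0}}\frac{\int_0^1 (u')^2h\,dx}{\int_0^1u^2h\,dx},\qquad \sigma_1(h)=\inf_{\substack{v\in H^1(0,1)\setminus\{0\}\\ \int_0^1 v\,dx=0}}\frac{\int_0^1 (v')^2h\,dx}{\int_0^1v^2\,dx}.$$ For $x_0\in(0,1)$ let $T_{x_0}(x)=2x/x_0$ if $x<x_0$ and $T_{x_0}(x)=2(1-x)/(1-x_0)$ if $x\ge x_0$; let $T_0(x)=2(1-x)$ and $T_1(x)=2x$. **Theorem 1.3.** Let $h\in\mathcal P_1$. Then $\sigma_1(h)>0$ and $$\frac{\mu_1(h)}{\sigma_1(h)}\le 2,$$ with equality if and only if there is $x_0\in[0,1]$ such that $h=T_{x_0}$ on $(0,1)$. If, in addition, $h(x)=h(1-x)$ for every $x\in(0,1)$, then $$\frac{\mu_1(h)}{\sigma_1(h)}\ge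 1.$$ -/

import Mathlib

open MeasureTheory Set

noncomputable section

/-- The class `𝒫` of profiles: functions in `L^∞(0,1)` that are non-negative, concave and not
identically zero. An element is represented by its concave representative on the open interval
`(0,1)`; the values of `h` outside of `(0,1)` are irrelevant. -/
def IsProfile (h : ℝ → ℝ) : Prop :=
  MemLp h ⊤ (volume.restrict (Ioo 0 1)) ∧
  (∀ x ∈ Ioo (0 : ℝ) 1, 0 ≤ h x) ∧
  ConcaveOn ℝ (Ioo (0 : ℝ) 1) h ∧
  ∃ x ∈ Ioo (0 : ℝ) 1, h x ≠ 0

/-- The class `𝒫₁` of profiles with unit integral. -/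
def IsUnitProfile (h : ℝ → ℝ) : Prop :=
  IsProfile h ∧ ∫ x in Ioo (0 : ℝ) 1, h x = 1

/-- `g` is a weak derivative of `u` on `(0,1)`: `∫ u φ' = - ∫ g φ` for all test functions
`φ ∈ C_c^∞(0,1)`. -/
def HasWeakDeriv (u g : ℝ → ℝ) : Prop :=
  ∀ φ : ℝ → ℝ, ContDiff ℝ (⊤ : ℕ∞) φ → HasCompactSupport φ → tsupport φ ⊆ Ioo 0 1 →
    ∫ x in Ioo (0 : ℝ) 1, u x * deriv φ x = -∫ x in Ioo (0 : ℝ) 1, g x * φ x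

/-- `u ∈ H¹(0,1)` with weak derivative `u' = g`. -/
def IsH1WithDeriv (u g : ℝ → ℝ) : Prop :=
  MemLp u 2 (volume.restrict (Ioo 0 1)) ∧ MemLp g 2 (volume.restrict (Ioo 0 1)) ∧
  HasWeakDeriv u g

/-- The Neumann eigenvalue
`μ₁(h) = inf { ∫ (u')² h / ∫ u² h : u ∈ H¹(0,1), u ≠ 0, ∫ u h = 0 }`. -/
def mu1 (h : ℝ → ℝ) : ℝ :=
  sInf {r : ℝ | ∃ u u' : ℝ → ℝ, IsH1WithDeriv u u' ∧
    ¬ u =ᵐ[volume.restrict (Ioo 0 1)] 0 ∧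
    ∫ x in Ioo (0 : ℝ) 1, u x * h x = 0 ∧
    r = (∫ x in Ioo (0 : ℝ) 1, u' x ^ 2 * h x) / ∫ x in Ioo (0 : ℝ) 1, u x ^ 2 * h x}

/-- The Steklov eigenvalue
`σ₁(h) = inf { ∫ (v')² h / ∫ v² : v ∈ H¹(0,1), v ≠ 0, ∫ v = 0 }`. -/
def sigma1 (h : ℝ → ℝ) : ℝ :=
  sInf {r : ℝ | ∃ v v' : ℝ → ℝ, IsH1WithDeriv v v' ∧
    ¬ v =ᵐ[volume.restrict (Ioo 0 1)] 0 ∧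
    ∫ x in Ioo (0 : ℝ) 1, v x = 0 ∧
    r = (∫ x in Ioo (0 : ℝ) 1, v' x ^ 2 * h x) / ∫ x in Ioo (0 : ℝ) 1, v x ^ 2}

/-- The triangular profile `T_{x₀}` of height `2` with vertex at `x₀ ∈ [0,1]`. -/
def triangle (x₀ x : ℝ) : ℝ :=
  if x₀ = 0 then 2 * (1 - x)
  else if x₀ = 1 then 2 * x
  else if x < x₀ then 2 * x / x₀
  else 2 * (1 - x) / (1 - x₀)

end

/-! Let H = `prim h`, an increasing bijection of [0,1] because h is positive with unit mass. If v
has mean zero, then u = v ∘ H satisfies ∫ u h = 0 and ∫ u² h = ∫ v², while ∫ (u')² h = ∫ (v')² ρ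
with ρ ∘ H = h². Concavity gives h² ≤ 2 h ∘ H (`IsUnitProfile.sq_le`), so ρ ≤ 2h and μ₁ ≤ 2σ₁.

Equality: if h² = 2 h ∘ H everywhere, every concavity estimate used is an equality and h is a
triangle (`IsUnitProfile.exists_triangle_of_sq_eq`). Conversely triangles satisfy this identity, and
then composition with H⁻¹ reverses the comparison (`sigma1_mul_le_of_sq_eq`). If instead the
inequality is strict at a point, it is strict on an interval. No minimiser of σ₁ is constructed, so
minimising sequences whose derivatives avoid that interval must be ruled out. A near-minimiser is
made monotone, then replaced by a solution w of -(h w')' = v, whose quotient is no larger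
(`inverse_iteration`). Now h w' = -`prim v` is concave and non-negative, so a Harnack inequality
puts a fixed fraction of the energy on any given interval (`exists_energy_lower_bound`). Hence μ₁ ≤
(2 - η)σ₁ with η > 0.

Positivity of σ₁: `prim v` vanishes at both ends and (`prim v`)² is controlled by x(1 - x), which
concavity also makes a lower bound for h up to a constant.

Symmetric case: the values of u - u(1/2) at x and 1 - x form a planar curve whose length is an odd
increasing function V. It has twice the energy of u and dominates both values; Chebyshev's
inequality then removes the weight from ∫ V² h. -/

open MeasureTheory Set Filter Topology

-- Primitives and integration by parts on (0,1).

local notation "ν" => (volume.restrict (Ioo (0 : ℝ) 1))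

/-- The primitive of `g` vanishing at `0`. -/
noncomputable def prim (g : ℝ → ℝ) (x : ℝ) : ℝ := ∫ t in (0 : ℝ)..x, g t

lemma intervalIntegrable_of_Ioo {g : ℝ → ℝ} (hg : Integrable g ν) :
    IntervalIntegrable g volume 0 1 :=
  (intervalIntegrable_iff_integrableOn_Ioo_of_le zero_le_one).2 hg

lemma intervalIntegrable_sub {g : ℝ → ℝ} (hg : Integrable g ν) {a b : ℝ}
    (ha : a ∈ Icc (0 : ℝ) 1) (hb : b ∈ Icc (0 : ℝ) 1) : IntervalIntegrable g volume a b :=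
  (intervalIntegrable_of_Ioo hg).mono_set (by
    rw [uIcc_of_le (zero_le_one' ℝ)]; exact uIcc_subset_Icc ha hb)

lemma intervalIntegral_eq_Ioo (g : ℝ → ℝ) : ∫ x in (0 : ℝ)..1, g x = ∫ x in Ioo (0 : ℝ) 1, g x := by
  rw [intervalIntegral.integral_of_le zero_le_one, integral_Ioc_eq_integral_Ioo]

lemma prim_zero (g : ℝ → ℝ) : prim g 0 = 0 := by simp [prim]

lemma prim_one (g : ℝ → ℝ) : prim g 1 = ∫ x in Ioo (0 : ℝ) 1, g x := intervalIntegral_eq_Ioo g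

lemma prim_sub {g : ℝ → ℝ} (hg : Integrable g ν) {a b : ℝ}
    (ha : a ∈ Icc (0 : ℝ) 1) (hb : b ∈ Icc (0 : ℝ) 1) : prim g b - prim g a = ∫ t in a..b, g t :=
  intervalIntegral.integral_interval_sub_left
    (intervalIntegrable_sub hg (by simp) hb) (intervalIntegrable_sub hg (by simp) ha)

lemma absCont_prim {g : ℝ → ℝ} (hg : Integrable g ν) (c : ℝ) :
    AbsolutelyContinuousOnInterval (fun x => c + prim g x) 0 1 := by
  have h1 := (intervalIntegrable_of_Ioo hg).absolutelyContinuousOnInterval_intervalIntegral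
    (c := 0) (by simp)
  have h2 : AbsolutelyContinuousOnInterval (fun _ : ℝ => c) 0 1 :=
    (contDiff_const.contDiffOn (n := 1) (s := uIcc (0:ℝ) 1)).absolutelyContinuousOnInterval
  exact h2.add h1

lemma continuousOn_prim {g : ℝ → ℝ} (hg : Integrable g ν) :
    ContinuousOn (prim g) (Icc 0 1) := by
  have := (absCont_prim hg 0).continuousOn
  simpa [uIcc_of_le (zero_le_one' ℝ)] using this

lemma ae_hasDerivAt_prim {g : ℝ → ℝ} (hg : Integrable g ν) (c : ℝ) :
    ∀ᵐ x ∂ν, HasDerivAt (fun x => c + prim g x) (g x) x := by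
  rw [ae_restrict_iff' measurableSet_Ioo]
  filter_upwards [(intervalIntegrable_of_Ioo hg).ae_hasDerivAt_integral] with x hx hx'
  refine (hx ?_ 0 (by simp)).const_add c
  rw [uIcc_of_le (zero_le_one' ℝ)]
  exact Ioo_subset_Icc_self hx'

/-- Integration by parts for primitives of integrable functions. -/
lemma integral_prim_mul {f g : ℝ → ℝ} (hf : Integrable f ν) (hg : Integrable g ν) (a b : ℝ) :
    ∫ x in Ioo (0 : ℝ) 1, (a + prim f x) * g x =
      (a + prim f 1) * (b + prim g 1) - a * b - ∫ x in Ioo (0 : ℝ) 1, f x * (b + prim g x) := by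
  have := (absCont_prim hf a).integral_mul_deriv_eq_deriv_mul (absCont_prim hg b)
  rw [intervalIntegral_eq_Ioo, intervalIntegral_eq_Ioo, prim_zero, prim_zero] at this
  simp only [add_zero] at this
  have e1 : ∫ x in Ioo (0 : ℝ) 1, (a + prim f x) * g x =
      ∫ x in Ioo (0 : ℝ) 1, (a + prim f x) * deriv (fun x => b + prim g x) x :=
    integral_congr_ae (by filter_upwards [ae_hasDerivAt_prim hg b] with x hx; rw [hx.deriv])
  have e2 : ∫ x in Ioo (0 : ℝ) 1, f x * (b + prim g x) =
      ∫ x in Ioo (0 : ℝ) 1, deriv (fun x => a + prim f x) x * (b + prim g x) :=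
    integral_congr_ae (by filter_upwards [ae_hasDerivAt_prim hf a] with x hx; rw [hx.deriv])
  rw [e1, e2, this]

lemma MeasureTheory.MemLp.integrable_Ioo {g : ℝ → ℝ} (hg : MemLp g 2 ν) : Integrable g ν :=
  hg.integrable (by norm_num)

/-! ### Weak derivatives and continuous representatives in H¹. -/

lemma eq_zero_of_tsupport_subset {φ : ℝ → ℝ} (h : tsupport φ ⊆ Ioo 0 1) {x : ℝ}
    (hx : x ∉ Ioo (0 : ℝ) 1) : φ x = 0 :=
  image_eq_zero_of_notMem_tsupport fun hh => hx (h hh)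

lemma prim_deriv {φ : ℝ → ℝ} (h1 : ContDiff ℝ (⊤ : ℕ∞) φ) (h3 : tsupport φ ⊆ Ioo 0 1) (x : ℝ) :
    prim (deriv φ) x = φ x := by
  have h0 : φ 0 = 0 := eq_zero_of_tsupport_subset h3 (by simp)
  rw [prim, intervalIntegral.integral_deriv_eq_sub, h0, sub_zero]
  · intro y _; exact (h1.differentiable (by simp)) y
  · exact (h1.continuous_deriv (by simp)).intervalIntegrable _ _

lemma hasWeakDeriv_prim {g : ℝ → ℝ} (hg : Integrable g ν) (c : ℝ) :
    HasWeakDeriv (fun x => c + prim g x) g := by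
  intro φ h1 h2 h3
  have hc : Continuous (deriv φ) := h1.continuous_deriv (by simp)
  have hi : Integrable (deriv φ) ν :=
    (hc.integrableOn_Icc (a := 0) (b := 1)).mono_set Ioo_subset_Icc_self
  have := integral_prim_mul hg hi c 0
  simp only [prim_deriv h1 h3, eq_zero_of_tsupport_subset h3 (x := 1) (by simp)] at this
  simpa using this

lemma memLp_prim {g : ℝ → ℝ} (hg : Integrable g ν) (c : ℝ) (p : ENNReal) :
    MemLp (fun x => c + prim g x) p ν := by
  have hc : ContinuousOn (fun x => c + prim g x) (Icc 0 1) :=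
    continuousOn_const.add (continuousOn_prim hg)
  obtain ⟨C, hC⟩ := isCompact_Icc.exists_bound_of_continuousOn hc
  refine MemLp.of_bound ((hc.mono Ioo_subset_Icc_self).aestronglyMeasurable measurableSet_Ioo) C ?_
  rw [ae_restrict_iff' measurableSet_Ioo]
  exact Filter.Eventually.of_forall fun x hx => hC x (Ioo_subset_Icc_self hx)

lemma isH1WithDeriv_prim {g : ℝ → ℝ} (hg : MemLp g 2 ν) (c : ℝ) :
    IsH1WithDeriv (fun x => c + prim g x) g :=
  ⟨memLp_prim hg.integrable_Ioo c 2, hg, hasWeakDeriv_prim hg.integrable_Ioo c⟩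

lemma exists_Icc_of_isCompact {K : Set ℝ} (hK : IsCompact K) (h : K ⊆ Ioo 0 1) :
    ∃ a b : ℝ, 0 < a ∧ b < 1 ∧ K ⊆ Icc a b := by
  rcases K.eq_empty_or_nonempty with rfl | hne
  · exact ⟨1/2, 1/2, by norm_num, by norm_num, by simp⟩
  · exact ⟨sInf K, sSup K, (h (hK.sInf_mem hne)).1, (h (hK.sSup_mem hne)).2,
      fun x hx => ⟨csInf_le hK.bddBelow hx, le_csSup hK.bddAbove hx⟩⟩

/-- A mean-zero test function on `(0,1)` is the derivative of a test function. -/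
lemma exists_test_primitive {f : ℝ → ℝ} (h1 : ContDiff ℝ (⊤ : ℕ∞) f) (h2 : HasCompactSupport f)
    (h3 : tsupport f ⊆ Ioo 0 1) (h4 : ∫ x in Ioo (0 : ℝ) 1, f x = 0) :
    ∃ ψ : ℝ → ℝ, ContDiff ℝ (⊤ : ℕ∞) ψ ∧ HasCompactSupport ψ ∧ tsupport ψ ⊆ Ioo 0 1 ∧
      deriv ψ = f := by
  have hd : ∀ x, HasDerivAt (prim f) (f x) x := fun x =>
    intervalIntegral.integral_hasDerivAt_right (h1.continuous.intervalIntegrable _ _)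
      h1.continuous.stronglyMeasurable.stronglyMeasurableAtFilter h1.continuous.continuousAt
  have hd' : deriv (prim f) = f := funext fun x => (hd x).deriv
  obtain ⟨a, b, ha, hb, hab⟩ := exists_Icc_of_isCompact h2 h3
  have hf0 : ∀ x, x ∉ Icc a b → f x = 0 := fun x hx =>
    image_eq_zero_of_notMem_tsupport fun hh => hx (hab hh)
  have hs : tsupport (prim f) ⊆ Icc a b := by
    refine closure_minimal ?_ isClosed_Icc
    intro x hx
    by_contra hx'
    apply hx
    by_cases hxa : x < a
    · rw [prim, intervalIntegral.integral_congr (g := fun _ => (0:ℝ)), intervalIntegral.integral_zero]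
      intro t ht
      refine hf0 t fun ht' => ?_
      rcases ht with ⟨_, h⟩
      have := max_lt ha hxa
      exact absurd (ht'.1.trans h) (not_le.2 this)
    -- To the right of the support the primitive keeps its value at 1, which is the total integral,
    -- hence 0.
    · have hxb : b < x := by
        by_contra h; exact hx' ⟨not_lt.1 hxa, not_lt.1 h⟩
      have e : prim f x - prim f 1 = ∫ t in (1:ℝ)..x, f t :=
        intervalIntegral.integral_interval_sub_left (h1.continuous.intervalIntegrable _ _)
          (h1.continuous.intervalIntegrable _ _)
      rw [intervalIntegral.integral_congr (g := fun _ => (0:ℝ)), intervalIntegral.integral_zero,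
        prim_one, h4, sub_zero] at e
      · exact e
      intro t ht
      refine hf0 t fun ht' => ?_
      rcases ht with ⟨h, _⟩
      exact absurd (h.trans ht'.2) (not_le.2 (lt_min hb hxb))
  refine ⟨prim f, ?_, HasCompactSupport.of_support_subset_isCompact isCompact_Icc
    ((subset_tsupport _).trans hs), hs.trans (Icc_subset_Ioo ha hb), hd'⟩
  rw [contDiff_infty_iff_deriv, hd']
  exact ⟨fun x => (hd x).differentiableAt, h1⟩

lemma exists_test_integral_one : ∃ η : ℝ → ℝ, ContDiff ℝ (⊤ : ℕ∞) η ∧ HasCompactSupport η ∧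
    tsupport η ⊆ Ioo 0 1 ∧ ∫ x in Ioo (0 : ℝ) 1, η x = 1 := by
  let B : ContDiffBump (1 / 2 : ℝ) := ⟨1/8, 1/4, by norm_num, by norm_num⟩
  have hs : tsupport (B.normed volume) ⊆ Ioo 0 1 := by
    rw [B.tsupport_normed_eq, Real.closedBall_eq_Icc]
    exact Icc_subset_Ioo (by norm_num [B]) (by norm_num [B])
  refine ⟨B.normed volume, B.contDiff_normed, B.hasCompactSupport_normed, hs, ?_⟩
  rw [setIntegral_eq_integral_of_forall_compl_eq_zero, B.integral_normed]
  exact fun x hx => eq_zero_of_tsupport_subset hs hx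

/-- A function on `(0,1)` with vanishing weak derivative is constant. -/
lemma ae_const_of_hasWeakDeriv_zero {u : ℝ → ℝ} (hu : Integrable u ν)
    (h : HasWeakDeriv u 0) : ∃ c, ∀ᵐ x ∂ν, u x = c := by
  obtain ⟨η, e1, e2, e3, e4⟩ := exists_test_integral_one
  have hint : ∀ φ : ℝ → ℝ, Continuous φ → Integrable φ ν ∧ Integrable (fun x => u x * φ x) ν := by
    intro φ hc
    refine ⟨(hc.integrableOn_Icc (a := 0) (b := 1)).mono_set Ioo_subset_Icc_self, ?_⟩
    obtain ⟨C, hC⟩ := isCompact_Icc.exists_bound_of_continuousOn (hc.continuousOn (s := Icc 0 1))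
    refine hu.mul_bdd (c := C) hc.aestronglyMeasurable ?_
    rw [ae_restrict_iff' measurableSet_Ioo]
    exact Filter.Eventually.of_forall fun x hx => hC x (Ioo_subset_Icc_self hx)
  set c := ∫ x in Ioo (0 : ℝ) 1, u x * η x with hcdef
  refine ⟨c, ?_⟩
  have key := isOpen_Ioo.ae_eq_zero_of_integral_contDiff_smul_eq_zero (U := Ioo (0:ℝ) 1)
    (f := fun x => u x - c) (μ := volume) ?_ ?_
  · rw [ae_restrict_iff' measurableSet_Ioo]
    filter_upwards [key] with x hx hx'
    exact sub_eq_zero.1 (hx hx')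
  · refine LocallyIntegrableOn.sub ?_ ?_
    · exact IntegrableOn.locallyIntegrableOn hu
    · exact (continuous_const.locallyIntegrable (μ := volume)).locallyIntegrableOn _
  · intro φ h1 h2 h3
    -- Du Bois-Reymond's argument: φ - mη has mean zero, so it is ψ' for a test function ψ; testing
    -- against ψ gives ∫ uφ = m ∫ uη = mc.
    set m := ∫ x in Ioo (0 : ℝ) 1, φ x with hm
    have hsub : tsupport (fun x => φ x - m * η x) ⊆ Ioo 0 1 := by
      refine (tsupport_sub φ (fun x => m * η x)).trans (union_subset h3 ?_)
      exact (tsupport_mul_subset_right (f := fun _ => m) (g := η)).trans e3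
    obtain ⟨ψ, p1, p2, p3, p4⟩ := exists_test_primitive (f := fun x => φ x - m * η x)
      (h1.sub (contDiff_const.mul e1)) (h2.sub (e2.mul_left)) hsub (by
        rw [integral_sub (hint φ h1.continuous).1 ((hint η e1.continuous).1.const_mul m),
          integral_const_mul, e4, mul_one, sub_self])
    have := h ψ p1 p2 p3
    simp only [p4, Pi.zero_apply, zero_mul, integral_zero, neg_zero] at this
    have e : ∀ x, u x * (φ x - m * η x) = u x * φ x - m * (u x * η x) := fun x => by ring
    simp only [e] at this
    rw [integral_sub (hint φ h1.continuous).2 ((hint η e1.continuous).2.const_mul m),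
      integral_const_mul] at this
    rw [← setIntegral_eq_integral_of_forall_compl_eq_zero (s := Ioo (0:ℝ) 1)]
    · simp only [smul_eq_mul, mul_sub]
      rw [integral_sub]
      · rw [integral_mul_const, ← hm]
        simp only [mul_comm (φ _)]
        linarith
      · simpa only [mul_comm] using (hint φ h1.continuous).2
      · exact (hint φ h1.continuous).1.mul_const c
    · intro x hx
      rw [eq_zero_of_tsupport_subset h3 hx, zero_smul]

/-- Both sides have weak derivative g, so their difference is constant. From here on every quotient
is evaluated on functions `c + prim g`, which are continuous on [0,1]. -/
lemma IsH1WithDeriv.ae_eq_prim {u g : ℝ → ℝ} (h : IsH1WithDeriv u g) :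
    ∃ c, ∀ᵐ x ∂ν, u x = c + prim g x := by
  obtain ⟨hu, hg, hw⟩ := h
  have hp := memLp_prim hg.integrable_Ioo 0 2
  obtain ⟨c, hc⟩ := ae_const_of_hasWeakDeriv_zero (u := fun x => u x - (0 + prim g x))
    (hu.integrable_Ioo.sub hp.integrable_Ioo) (by
      intro φ h1 h2 h3
      have a := hw φ h1 h2 h3
      have b := hasWeakDeriv_prim hg.integrable_Ioo 0 φ h1 h2 h3
      have hc : Continuous (deriv φ) := h1.continuous_deriv (by simp)
      have hd : MemLp (deriv φ) 2 ν := by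
        obtain ⟨C, hC⟩ := isCompact_Icc.exists_bound_of_continuousOn (hc.continuousOn (s := Icc 0 1))
        refine MemLp.of_bound hc.aestronglyMeasurable C ?_
        rw [ae_restrict_iff' measurableSet_Ioo]
        exact Filter.Eventually.of_forall fun x hx => hC x (Ioo_subset_Icc_self hx)
      simp only [sub_mul]
      refine (integral_sub (hu.integrable_mul hd) (hp.integrable_mul hd)).trans ?_
      simp only [Pi.mul_apply, a, b]
      simp)
  exact ⟨c, hc.mono fun x hx => by linarith⟩

/-! ### Concave profiles. -/

/-- This says that h(x)/x is non-increasing. As 0 is outside the domain, the chord starts at y > 0,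
the non-negative term in h(y) is dropped, and y tends to 0. -/
lemma ConcaveOn.mul_le_mul_of_nonneg_Ioo {h : ℝ → ℝ} (hc : ConcaveOn ℝ (Ioo (0 : ℝ) 1) h)
    (h0 : ∀ x ∈ Ioo (0 : ℝ) 1, 0 ≤ h x) {x z : ℝ} (hx : 0 < x) (hxz : x ≤ z) (hz : z < 1) :
    x * h z ≤ z * h x := by
  have key : ∀ y ∈ Ioo 0 x, (x - y) * h z ≤ (z - y) * h x := by
    intro y hy
    have hzy : 0 < z - y := by linarith [hy.2]
    have hyI : y ∈ Ioo (0 : ℝ) 1 := ⟨hy.1, by linarith [hy.2]⟩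
    have hzI : z ∈ Ioo (0 : ℝ) 1 := ⟨by linarith, hz⟩
    have ha : 0 ≤ (z - x) / (z - y) := div_nonneg (by linarith) hzy.le
    have hb : 0 ≤ (x - y) / (z - y) := div_nonneg (by linarith [hy.2]) hzy.le
    have := hc.2 hyI hzI ha hb (by field_simp; ring)
    have e : (z - x) / (z - y) * y + (x - y) / (z - y) * z = x := by field_simp; ring
    simp only [smul_eq_mul, e] at this
    have h1 : 0 ≤ (z - x) / (z - y) * h y :=
      mul_nonneg (div_nonneg (by linarith) hzy.le) (h0 y hyI)
    have h2 : (x - y) / (z - y) * h z ≤ h x := by linarith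
    have h3 := mul_le_mul_of_nonneg_left h2 hzy.le
    have e2 : (z - y) * ((x - y) / (z - y) * h z) = (x - y) * h z := by field_simp
    linarith
  have l1 : Tendsto (fun y => (x - y) * h z) (𝓝[>] 0) (𝓝 ((x - 0) * h z)) :=
    ((continuous_const.sub continuous_id).mul continuous_const).continuousAt.tendsto.mono_left
      nhdsWithin_le_nhds
  have l2 : Tendsto (fun y => (z - y) * h x) (𝓝[>] 0) (𝓝 ((z - 0) * h x)) :=
    ((continuous_const.sub continuous_id).mul continuous_const).continuousAt.tendsto.mono_left
      nhdsWithin_le_nhds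
  have := le_of_tendsto_of_tendsto l1 l2 (by
    filter_upwards [Ioo_mem_nhdsGT hx] with y hy using key y hy)
  simpa using this

lemma ConcaveOn.comp_one_sub {h : ℝ → ℝ} (hc : ConcaveOn ℝ (Ioo (0 : ℝ) 1) h) :
    ConcaveOn ℝ (Ioo (0 : ℝ) 1) fun x => h (1 - x) := by
  refine ⟨convex_Ioo _ _, fun x hx y hy a b ha hb hab => ?_⟩
  have := hc.2 (x := 1 - x) ⟨by linarith [hx.2], by linarith [hx.1]⟩ (y := 1 - y)
    ⟨by linarith [hy.2], by linarith [hy.1]⟩ ha hb hab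
  simp only [smul_eq_mul] at this ⊢
  have e : a * (1 - x) + b * (1 - y) = 1 - (a * x + b * y) := by linear_combination hab
  rwa [e] at this

lemma ConcaveOn.one_sub_mul_le_mul_of_nonneg_Ioo {h : ℝ → ℝ} (hc : ConcaveOn ℝ (Ioo (0 : ℝ) 1) h)
    (h0 : ∀ x ∈ Ioo (0 : ℝ) 1, 0 ≤ h x) {x z : ℝ} (hx : 0 < x) (hxz : x ≤ z) (hz : z < 1) :
    (1 - z) * h x ≤ (1 - x) * h z := by
  have := hc.comp_one_sub.mul_le_mul_of_nonneg_Ioo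
    (fun y hy => h0 (1 - y) ⟨by linarith [hy.2], by linarith [hy.1]⟩)
    (x := 1 - z) (z := 1 - x) (by linarith) (by linarith) (by linarith)
  simpa using this

namespace IsProfile

variable {h : ℝ → ℝ}

lemma left_le (hh : IsProfile h) {x z : ℝ} (hx : 0 < x) (hxz : x ≤ z) (hz : z < 1) :
    x * h z ≤ z * h x := hh.2.2.1.mul_le_mul_of_nonneg_Ioo hh.2.1 hx hxz hz

lemma right_le (hh : IsProfile h) {x z : ℝ} (hx : 0 < x) (hxz : x ≤ z) (hz : z < 1) :
    (1 - z) * h x ≤ (1 - x) * h z := hh.2.2.1.one_sub_mul_le_mul_of_nonneg_Ioo hh.2.1 hx hxz hz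

lemma pos (hh : IsProfile h) {x : ℝ} (hx : x ∈ Ioo (0 : ℝ) 1) : 0 < h x := by
  obtain ⟨z, hz, hz0⟩ := hh.2.2.2
  have hzp : 0 < h z := lt_of_le_of_ne (hh.2.1 z hz) (Ne.symm hz0)
  rcases le_total x z with hxz | hxz
  · have := hh.left_le hx.1 hxz hz.2
    exact pos_of_mul_pos_right ((mul_pos hx.1 hzp).trans_le this) hz.1.le
  · have := hh.right_le hz.1 hxz hx.2
    exact pos_of_mul_pos_right ((mul_pos (sub_pos.2 hx.2) hzp).trans_le this) (sub_pos.2 hz.2).le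

lemma half_pos (hh : IsProfile h) : 0 < h (1 / 2) := hh.pos ⟨by norm_num, by norm_num⟩

/-- The chord bound is 2 h(1/2) min(x, 1 - x); the weaker weight x(1 - x) is smooth and cancels the
one in `prim_sq_le_of_integral_eq_zero`. -/
lemma lower_bound (hh : IsProfile h) {x : ℝ} (hx : x ∈ Ioo (0 : ℝ) 1) :
    h (1 / 2) * (x * (1 - x)) ≤ h x := by
  have hp := hh.half_pos
  have h1 := mul_pos hp (mul_pos hx.1 hx.1)
  have h2 := mul_pos hp (mul_pos (sub_pos.2 hx.2) (sub_pos.2 hx.2))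
  have h3 := mul_pos hp hx.1
  have h4 := mul_pos hp (sub_pos.2 hx.2)
  rcases le_total x (1 / 2) with hxz | hxz
  · have := hh.left_le hx.1 hxz (by norm_num)
    nlinarith
  · have := hh.right_le (by norm_num) hxz hx.2
    nlinarith

lemma upper_bound (hh : IsProfile h) {x : ℝ} (hx : x ∈ Ioo (0 : ℝ) 1) : h x ≤ 2 * h (1 / 2) := by
  have hp := hh.half_pos
  have hx0 := hh.pos hx
  rcases le_total x (1 / 2) with hxz | hxz
  · have := hh.right_le hx.1 hxz (by norm_num)
    nlinarith [mul_pos hp hx.1]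
  · have := hh.left_le (by norm_num) hxz hx.2
    nlinarith [mul_pos hp (sub_pos.2 hx.2)]

lemma continuousOn (hh : IsProfile h) : ContinuousOn h (Ioo 0 1) :=
  hh.2.2.1.continuousOn isOpen_Ioo

lemma continuousAt (hh : IsProfile h) {x : ℝ} (hx : x ∈ Ioo (0 : ℝ) 1) : ContinuousAt h x :=
  hh.continuousOn.continuousAt (Ioo_mem_nhds hx.1 hx.2)

lemma aestronglyMeasurable (hh : IsProfile h) : AEStronglyMeasurable h ν :=
  hh.continuousOn.aestronglyMeasurable measurableSet_Ioo

lemma integrable (hh : IsProfile h) : Integrable h ν := hh.1.integrable (by simp)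

lemma norm_bound (hh : IsProfile h) : ∀ᵐ x ∂ν, ‖h x‖ ≤ 2 * h (1 / 2) := by
  rw [ae_restrict_iff' measurableSet_Ioo]
  exact Filter.Eventually.of_forall fun x hx => by
    rw [Real.norm_of_nonneg (hh.pos hx).le]; exact hh.upper_bound hx

lemma integrable_mul (hh : IsProfile h) {f : ℝ → ℝ} (hf : Integrable f ν) :
    Integrable (fun x => f x * h x) ν :=
  hf.mul_bdd hh.aestronglyMeasurable hh.norm_bound

lemma hasDerivAt_prim (hh : IsProfile h) {x : ℝ} (hx : x ∈ Ioo (0 : ℝ) 1) :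
    HasDerivAt (prim h) (h x) x :=
  intervalIntegral.integral_hasDerivAt_right
    (intervalIntegrable_sub hh.integrable (by simp) (Ioo_subset_Icc_self hx))
    (hh.continuousOn.stronglyMeasurableAtFilter isOpen_Ioo x hx) (hh.continuousAt hx)

lemma strictMonoOn_prim (hh : IsProfile h) : StrictMonoOn (prim h) (Icc 0 1) := by
  refine strictMonoOn_of_deriv_pos (convex_Icc _ _) (continuousOn_prim hh.integrable) ?_
  intro x hx
  rw [interior_Icc] at hx
  rw [(hh.hasDerivAt_prim hx).deriv]
  exact hh.pos hx

lemma image_prim (hh : IsProfile h) {a b : ℝ} (ha : 0 ≤ a) (hab : a ≤ b) (hb : b ≤ 1) :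
    prim h '' Ioo a b = Ioo (prim h a) (prim h b) := by
  apply Subset.antisymm
  · rintro _ ⟨x, hx, rfl⟩
    exact ⟨hh.strictMonoOn_prim ⟨ha, by linarith⟩ ⟨by linarith [hx.1], by linarith [hx.2]⟩ hx.1,
      hh.strictMonoOn_prim ⟨by linarith [hx.1], by linarith [hx.2]⟩ ⟨by linarith, hb⟩ hx.2⟩
  · exact intermediate_value_Ioo hab
      ((continuousOn_prim hh.integrable).mono (Icc_subset_Icc ha hb))

/-- The substitution y = `prim h x`, valid for every F without an integrability hypothesis. -/
lemma integral_image (hh : IsProfile h) {a b : ℝ} (ha : 0 ≤ a) (hab : a ≤ b) (hb : b ≤ 1)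
    (F : ℝ → ℝ) :
    ∫ y in Ioo (prim h a) (prim h b), F y = ∫ x in Ioo a b, h x * F (prim h x) := by
  have hsub : Ioo a b ⊆ Ioo (0 : ℝ) 1 := Ioo_subset_Ioo ha hb
  rw [← hh.image_prim ha hab hb, integral_image_eq_integral_abs_deriv_smul measurableSet_Ioo
    (fun x hx => (hh.hasDerivAt_prim (hsub hx)).hasDerivWithinAt)
    (hh.strictMonoOn_prim.injOn.mono (hsub.trans Ioo_subset_Icc_self))]
  exact setIntegral_congr_fun measurableSet_Ioo fun x hx => by
    simp [abs_of_pos (hh.pos (hsub hx))]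

end IsProfile

/-! ### The change of variables by the primitive of h, and the pointwise inequality. -/

namespace IsUnitProfile

variable {h : ℝ → ℝ}

lemma prim_one (hh : IsUnitProfile h) : prim h 1 = 1 := by rw [_root_.prim_one, hh.2]

lemma prim_mem_Ioo (hh : IsUnitProfile h) {x : ℝ} (hx : x ∈ Ioo (0 : ℝ) 1) :
    prim h x ∈ Ioo (0 : ℝ) 1 := by
  have := hh.1.image_prim le_rfl zero_le_one le_rfl
  rw [prim_zero, hh.prim_one] at this
  exact this ▸ mem_image_of_mem _ hx

lemma prim_mem_Icc (hh : IsUnitProfile h) {x : ℝ} (hx : x ∈ Icc (0 : ℝ) 1) :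
    prim h x ∈ Icc (0 : ℝ) 1 := by
  have hm := hh.1.strictMonoOn_prim.monotoneOn
  constructor
  · simpa [prim_zero] using hm (by simp) hx hx.1
  · simpa [hh.prim_one] using hm hx (by simp) hx.2

lemma integral_comp (hh : IsUnitProfile h) (F : ℝ → ℝ) :
    ∫ y in Ioo (0 : ℝ) 1, F y = ∫ x in Ioo (0 : ℝ) 1, h x * F (prim h x) := by
  have := hh.1.integral_image le_rfl zero_le_one le_rfl F
  rwa [prim_zero, hh.prim_one] at this

lemma integrable_comp_iff (hh : IsUnitProfile h) (F : ℝ → ℝ) :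
    Integrable F ν ↔ Integrable (fun x => h x * F (prim h x)) ν := by
  have e := hh.1.image_prim le_rfl zero_le_one le_rfl
  rw [prim_zero, hh.prim_one] at e
  have := integrableOn_image_iff_integrableOn_abs_deriv_smul measurableSet_Ioo
    (fun x hx => (hh.1.hasDerivAt_prim hx).hasDerivWithinAt)
    (hh.1.strictMonoOn_prim.injOn.mono Ioo_subset_Icc_self) F
  rw [e] at this
  refine this.trans (integrableOn_congr_fun (fun x hx => ?_) measurableSet_Ioo)
  simp [abs_of_pos (hh.1.pos hx)]

/-- Chain rule: the composition of `prim g` with `prim h` is again a primitive, so it is admissible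
as a test function. -/
lemma prim_comp (hh : IsUnitProfile h) (g : ℝ → ℝ) {x : ℝ} (hx : x ∈ Icc (0 : ℝ) 1) :
    prim (fun t => h t * g (prim h t)) x = prim g (prim h x) := by
  have := hh.1.integral_image le_rfl hx.1 hx.2 g
  rw [prim_zero] at this
  rw [prim, prim, intervalIntegral.integral_of_le hx.1,
    intervalIntegral.integral_of_le (hh.prim_mem_Icc hx).1, integral_Ioc_eq_integral_Ioo,
    integral_Ioc_eq_integral_Ioo, this]

/-- The square is h · (h · g(H)²): a bounded factor times the pull-back of the integrable function
g². -/
lemma memLp_comp (hh : IsUnitProfile h) {g : ℝ → ℝ} (hg : MemLp g 2 ν) :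
    MemLp (fun x => h x * g (prim h x)) 2 ν := by
  have h1 := (hh.integrable_comp_iff g).1 hg.integrable_Ioo
  have h2 := (hh.integrable_comp_iff _).1 hg.integrable_sq
  rw [memLp_two_iff_integrable_sq h1.aestronglyMeasurable]
  refine (hh.1.integrable_mul h2).congr (Eventually.of_forall fun x => ?_)
  ring

/-- On (0,x) the graph lies above the segment from the origin to (x, h(x)); compare areas. -/
lemma mul_le_two_mul_prim (hh : IsUnitProfile h) {x : ℝ} (hx : x ∈ Ioo (0 : ℝ) 1) :
    x * h x ≤ 2 * prim h x := by
  have h1 : ∫ t in (0:ℝ)..x, t * (h x / x) ≤ prim h x := by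
    refine intervalIntegral.integral_mono_on_of_le_Ioo hx.1.le
      (Continuous.intervalIntegrable (by fun_prop) _ _)
      (intervalIntegrable_sub hh.1.integrable (by simp) (Ioo_subset_Icc_self hx)) ?_
    intro t ht
    have := hh.1.left_le ht.1 ht.2.le hx.2
    rw [mul_div_assoc', div_le_iff₀ hx.1]
    linarith
  rw [intervalIntegral.integral_mul_const, integral_id] at h1
  have e : (x ^ 2 - 0 ^ 2) / 2 * (h x / x) = x * h x / 2 := by
    have := hx.1.ne'
    field_simp; ring
  linarith

lemma one_sub_mul_le (hh : IsUnitProfile h) {x : ℝ} (hx : x ∈ Ioo (0 : ℝ) 1) :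
    (1 - x) * h x ≤ 2 * (1 - prim h x) := by
  have h1 : ∫ t in x..1, (1 - t) * (h x / (1 - x)) ≤ ∫ t in x..1, h t := by
    refine intervalIntegral.integral_mono_on_of_le_Ioo hx.2.le
      (Continuous.intervalIntegrable (by fun_prop) _ _)
      (intervalIntegrable_sub hh.1.integrable (Ioo_subset_Icc_self hx) (by simp)) ?_
    intro t ht
    have := hh.1.right_le hx.1 ht.1.le ht.2
    rw [mul_div_assoc', div_le_iff₀ (sub_pos.2 hx.2)]
    linarith
  rw [← prim_sub hh.1.integrable (Ioo_subset_Icc_self hx) (by simp), hh.prim_one,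
    intervalIntegral.integral_mul_const, intervalIntegral.integral_sub (by simp) (by simp),
    integral_id, intervalIntegral.integral_const] at h1
  have e : ((1 - x) • (1:ℝ) - (1 ^ 2 - x ^ 2) / 2) * (h x / (1 - x)) = (1 - x) * h x / 2 := by
    have := (sub_pos.2 hx.2).ne'
    simp only [smul_eq_mul]
    field_simp; ring
  linarith

/-- The pointwise comparison between the transplanted profile and twice the profile. -/
lemma sq_le (hh : IsUnitProfile h) {x : ℝ} (hx : x ∈ Ioo (0 : ℝ) 1) :
    h x ^ 2 ≤ 2 * h (prim h x) := by
  have hp := hh.prim_mem_Ioo hx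
  have h0 := hh.1.pos hx
  -- If H(x) ≤ x, then x h(H(x)) ≥ H(x) h(x) ≥ x h(x)² / 2. Otherwise the same chain runs from the
  -- endpoint 1.
  rcases le_total (prim h x) x with hle | hle
  · have h1 := hh.1.left_le hp.1 hle hx.2
    have h2 := mul_le_mul_of_nonneg_right (hh.mul_le_two_mul_prim hx) h0.le
    have : x * h x ^ 2 ≤ x * (2 * h (prim h x)) := by nlinarith
    exact le_of_mul_le_mul_left this hx.1
  · have h1 := hh.1.right_le hx.1 hle hp.2
    have h2 := mul_le_mul_of_nonneg_right (hh.one_sub_mul_le hx) h0.le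
    have : (1 - x) * h x ^ 2 ≤ (1 - x) * (2 * h (prim h x)) := by nlinarith
    exact le_of_mul_le_mul_left this (sub_pos.2 hx.2)

end IsUnitProfile

/-! ### Variational characterisations on primitives. -/

lemma integrable_Ioo_of_continuousOn {f : ℝ → ℝ} (hf : ContinuousOn f (Icc 0 1)) :
    Integrable f ν :=
  (hf.integrableOn_Icc (μ := volume)).mono_set Ioo_subset_Icc_self

lemma continuousOn_const_add_prim {g : ℝ → ℝ} (hg : MemLp g 2 ν) (c : ℝ) :
    ContinuousOn (fun x => c + prim g x) (Icc 0 1) :=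
  continuousOn_const.add (continuousOn_prim hg.integrable_Ioo)

lemma integral_Ioo_const (c : ℝ) : ∫ _ in Ioo (0 : ℝ) 1, c = c := by simp

lemma integral_sq_mul_nonneg {h : ℝ → ℝ} (hh : IsProfile h) (g : ℝ → ℝ) :
    0 ≤ ∫ x in Ioo (0 : ℝ) 1, g x ^ 2 * h x :=
  setIntegral_nonneg measurableSet_Ioo fun x hx => mul_nonneg (sq_nonneg _) (hh.2.1 x hx)

lemma integral_sq_nonneg_Ioo (g : ℝ → ℝ) : 0 ≤ ∫ x in Ioo (0 : ℝ) 1, g x ^ 2 :=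
  integral_nonneg fun _ => sq_nonneg _

lemma bddBelow_sigma1 {h : ℝ → ℝ} (hh : IsProfile h) :
    BddBelow {r : ℝ | ∃ v v' : ℝ → ℝ, IsH1WithDeriv v v' ∧
    ¬ v =ᵐ[volume.restrict (Ioo 0 1)] 0 ∧
    ∫ x in Ioo (0 : ℝ) 1, v x = 0 ∧
    r = (∫ x in Ioo (0 : ℝ) 1, v' x ^ 2 * h x) / ∫ x in Ioo (0 : ℝ) 1, v x ^ 2} := by
  refine ⟨0, ?_⟩
  rintro _ ⟨v, v', -, -, -, rfl⟩
  exact div_nonneg (integral_sq_mul_nonneg hh v') (integral_sq_nonneg_Ioo v)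

lemma bddBelow_mu1 {h : ℝ → ℝ} (hh : IsProfile h) :
    BddBelow {r : ℝ | ∃ u u' : ℝ → ℝ, IsH1WithDeriv u u' ∧
    ¬ u =ᵐ[volume.restrict (Ioo 0 1)] 0 ∧
    ∫ x in Ioo (0 : ℝ) 1, u x * h x = 0 ∧
    r = (∫ x in Ioo (0 : ℝ) 1, u' x ^ 2 * h x) / ∫ x in Ioo (0 : ℝ) 1, u x ^ 2 * h x} := by
  refine ⟨0, ?_⟩
  rintro _ ⟨v, v', -, -, -, rfl⟩
  exact div_nonneg (integral_sq_mul_nonneg hh v') (integral_sq_mul_nonneg hh v)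

lemma integral_sub_mean_sq {v : ℝ → ℝ} (hv : ContinuousOn v (Icc 0 1)) :
    ∫ x in Ioo (0 : ℝ) 1, (v x - ∫ y in Ioo (0 : ℝ) 1, v y) ^ 2 =
      (∫ x in Ioo (0 : ℝ) 1, v x ^ 2) - (∫ x in Ioo (0 : ℝ) 1, v x) ^ 2 := by
  set m := ∫ y in Ioo (0 : ℝ) 1, v y with hm
  have e : ∀ x, (v x - m) ^ 2 = v x ^ 2 - (2 * m) * v x + m ^ 2 := fun x => by ring
  have i1 := integrable_Ioo_of_continuousOn hv
  have i2 : Integrable (fun x => v x ^ 2) ν := integrable_Ioo_of_continuousOn (hv.pow 2)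
  have i3 : Integrable (fun x => v x ^ 2 - (2 * m) * v x) ν := i2.sub (i1.const_mul _)
  simp only [e]
  rw [integral_add i3 (integrable_const _),
    integral_sub i2 (i1.const_mul _), integral_const_mul, integral_Ioo_const, ← hm]
  ring

/-- Subtracting the mean turns the constraint into a variance. Without a division the bound also
covers constants and needs no normalisation of c. -/
lemma sigma1_mul_le {h : ℝ → ℝ} (hh : IsProfile h) {g : ℝ → ℝ} (hg : MemLp g 2 ν) (c : ℝ) :
    sigma1 h * ((∫ x in Ioo (0 : ℝ) 1, (c + prim g x) ^ 2) -
      (∫ x in Ioo (0 : ℝ) 1, (c + prim g x)) ^ 2) ≤ ∫ x in Ioo (0 : ℝ) 1, g x ^ 2 * h x := by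
  have hv := continuousOn_const_add_prim hg c
  rw [← integral_sub_mean_sq hv]
  set m := ∫ y in Ioo (0 : ℝ) 1, (c + prim g y) with hm
  have hE := integral_sq_mul_nonneg hh g
  rcases (integral_sq_nonneg_Ioo fun x => c + prim g x - m).eq_or_lt with h0 | h0
  · rw [← h0, mul_zero]; exact hE
  · rw [← le_div_iff₀ h0]
    refine csInf_le (bddBelow_sigma1 hh) ⟨fun x => c + prim g x - m, g, ?_, ?_, ?_, rfl⟩
    · have := isH1WithDeriv_prim hg (c - m)
      convert this using 2
      ring
    · intro hae
      refine h0.ne' ?_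
      rw [integral_congr_ae (g := fun _ => (0:ℝ)) (hae.mono fun x hx => by simp [hx])]
      simp
    · rw [integral_sub (integrable_Ioo_of_continuousOn hv) (integrable_const _), ← hm,
        integral_Ioo_const, sub_self]

lemma integral_sub_mean_sq_mul {h : ℝ → ℝ} (hh : IsUnitProfile h) {v : ℝ → ℝ}
    (hv : ContinuousOn v (Icc 0 1)) :
    ∫ x in Ioo (0 : ℝ) 1, (v x - ∫ y in Ioo (0 : ℝ) 1, v y * h y) ^ 2 * h x =
      (∫ x in Ioo (0 : ℝ) 1, v x ^ 2 * h x) - (∫ x in Ioo (0 : ℝ) 1, v x * h x) ^ 2 := by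
  set m := ∫ y in Ioo (0 : ℝ) 1, v y * h y with hm
  have e : ∀ x, (v x - m) ^ 2 * h x = v x ^ 2 * h x - (2 * m) * (v x * h x) + m ^ 2 * h x :=
    fun x => by ring
  have i1 := hh.1.integrable_mul (integrable_Ioo_of_continuousOn hv)
  have i2 : Integrable (fun x => v x ^ 2 * h x) ν :=
    hh.1.integrable_mul (integrable_Ioo_of_continuousOn (hv.pow 2))
  have i3 : Integrable (fun x => v x ^ 2 * h x - (2 * m) * (v x * h x)) ν :=
    i2.sub (i1.const_mul _)
  simp only [e]
  rw [integral_add i3 (hh.1.integrable.const_mul _),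
    integral_sub i2 (i1.const_mul _), integral_const_mul, integral_const_mul, hh.2, ← hm]
  ring

lemma mu1_mul_le {h : ℝ → ℝ} (hh : IsUnitProfile h) {g : ℝ → ℝ} (hg : MemLp g 2 ν) (c : ℝ) :
    mu1 h * ((∫ x in Ioo (0 : ℝ) 1, (c + prim g x) ^ 2 * h x) -
      (∫ x in Ioo (0 : ℝ) 1, (c + prim g x) * h x) ^ 2) ≤
      ∫ x in Ioo (0 : ℝ) 1, g x ^ 2 * h x := by
  have hv := continuousOn_const_add_prim hg c
  rw [← integral_sub_mean_sq_mul hh hv]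
  set m := ∫ y in Ioo (0 : ℝ) 1, (c + prim g y) * h y with hm
  have hE := integral_sq_mul_nonneg hh.1 g
  rcases (integral_sq_mul_nonneg hh.1 fun x => c + prim g x - m).eq_or_lt with h0 | h0
  · rw [← h0, mul_zero]; exact hE
  · rw [← le_div_iff₀ h0]
    refine csInf_le (bddBelow_mu1 hh.1) ⟨fun x => c + prim g x - m, g, ?_, ?_, ?_, rfl⟩
    · have := isH1WithDeriv_prim hg (c - m)
      convert this using 2
      ring
    · intro hae
      refine h0.ne' ?_
      rw [integral_congr_ae (g := fun _ => (0:ℝ)) (hae.mono fun x hx => by simp [hx])]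
      simp
    · simp only [sub_mul]
      rw [integral_sub (hh.1.integrable_mul (integrable_Ioo_of_continuousOn hv))
        (hh.1.integrable.const_mul _), ← hm, integral_const_mul, hh.2, mul_one, sub_self]

lemma prim_const_one : prim (fun _ => 1) = fun x => x := by
  funext x; simp [prim]

/-- The functions x - m show that the sets defining both eigenvalues are non-empty, which matters
because `sInf ∅ = 0`. -/
lemma integral_sub_const_sq_pos (m : ℝ) :
    0 < ∫ x in Ioo (0 : ℝ) 1, (-m + prim (fun _ => 1) x) ^ 2 := by
  rw [prim_const_one, ← intervalIntegral_eq_Ioo]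
  have e : ∀ x : ℝ, (-m + x) ^ 2 = x ^ 2 - (2 * m) * x + m ^ 2 := fun x => by ring
  simp only [e]
  rw [intervalIntegral.integral_add (Continuous.intervalIntegrable (by fun_prop) _ _)
    (Continuous.intervalIntegrable (by fun_prop) _ _),
    intervalIntegral.integral_sub (Continuous.intervalIntegrable (by fun_prop) _ _)
    (Continuous.intervalIntegrable (by fun_prop) _ _), intervalIntegral.integral_const_mul,
    integral_pow, integral_id, intervalIntegral.integral_const]
  norm_num
  nlinarith [sq_nonneg (m - 1/2)]

lemma not_ae_zero_sub_const (m : ℝ) : ¬ (fun x => -m + prim (fun _ => 1) x) =ᵐ[ν] 0 := by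
  intro hae
  refine (integral_sub_const_sq_pos m).ne' ?_
  rw [integral_congr_ae (g := fun _ => (0:ℝ)) (hae.mono fun x hx => by simp [hx])]
  simp

lemma integral_sq_mul_pos {h : ℝ → ℝ} (hpos : ∀ x ∈ Ioo (0 : ℝ) 1, 0 < h x) {v : ℝ → ℝ}
    (hi : Integrable (fun x => v x ^ 2 * h x) ν) (hv : ¬ v =ᵐ[ν] 0) :
    0 < ∫ x in Ioo (0 : ℝ) 1, v x ^ 2 * h x := by
  have hnn : 0 ≤ᵐ[ν] fun x => v x ^ 2 * h x := by
    rw [EventuallyLE, ae_restrict_iff' measurableSet_Ioo]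
    exact Eventually.of_forall fun x hx => mul_nonneg (sq_nonneg _) (hpos x hx).le
  refine lt_of_le_of_ne (integral_nonneg_of_ae hnn) fun h0 => hv ?_
  have := (integral_eq_zero_iff_of_nonneg_ae hnn hi).1 h0.symm
  rw [EventuallyEq, ae_restrict_iff' measurableSet_Ioo] at this ⊢
  filter_upwards [this] with x hx hx'
  have h1 := hx hx'
  simpa [(hpos x hx').ne'] using h1

lemma memLp_const_Ioo (c : ℝ) : MemLp (fun _ : ℝ => c) 2 ν := memLp_const c

/-- To bound `sigma1` from below it suffices to consider mean-zero primitives. -/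
lemma le_sigma1 {h : ℝ → ℝ} {a : ℝ}
    (H : ∀ (g : ℝ → ℝ) (c : ℝ), MemLp g 2 ν → ∫ x in Ioo (0 : ℝ) 1, (c + prim g x) = 0 →
      a * ∫ x in Ioo (0 : ℝ) 1, (c + prim g x) ^ 2 ≤ ∫ x in Ioo (0 : ℝ) 1, g x ^ 2 * h x) :
    a ≤ sigma1 h := by
  refine le_csInf ⟨_, fun x => -(1/2) + prim (fun _ => 1) x, fun _ => 1,
    isH1WithDeriv_prim (memLp_const_Ioo 1) _, not_ae_zero_sub_const _, ?_, rfl⟩ ?_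
  · rw [prim_const_one, ← intervalIntegral_eq_Ioo, intervalIntegral.integral_add
      (Continuous.intervalIntegrable (by fun_prop) _ _)
      (Continuous.intervalIntegrable (by fun_prop) _ _), integral_id]
    norm_num
  · rintro _ ⟨v, g, hv, h0, hm, rfl⟩
    obtain ⟨c, hc⟩ := hv.ae_eq_prim
    have hpos : 0 < ∫ x in Ioo (0 : ℝ) 1, v x ^ 2 := by
      have := integral_sq_mul_pos (h := fun _ => 1) (fun _ _ => one_pos)
        (by simpa using hv.1.integrable_sq) h0
      simpa using this
    rw [le_div_iff₀ hpos, integral_congr_ae (hc.mono fun x hx => by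
      show v x ^ 2 = (c + prim g x) ^ 2
      rw [hx])]
    exact H g c hv.2.1 ((integral_congr_ae (hc.mono fun x hx => hx.symm)).trans hm)

/-- To bound `mu1` from below it suffices to consider primitives of weighted mean zero. -/
lemma le_mu1 {h : ℝ → ℝ} (hh : IsUnitProfile h) {a : ℝ}
    (H : ∀ (g : ℝ → ℝ) (c : ℝ), MemLp g 2 ν → ∫ x in Ioo (0 : ℝ) 1, (c + prim g x) * h x = 0 →
      a * ∫ x in Ioo (0 : ℝ) 1, (c + prim g x) ^ 2 * h x ≤
        ∫ x in Ioo (0 : ℝ) 1, g x ^ 2 * h x) :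
    a ≤ mu1 h := by
  refine le_csInf ⟨_, fun x => -(∫ y in Ioo (0 : ℝ) 1, y * h y) + prim (fun _ => 1) x, fun _ => 1,
    isH1WithDeriv_prim (memLp_const_Ioo 1) _, not_ae_zero_sub_const _, ?_, rfl⟩ ?_
  · simp only [prim_const_one, add_mul]
    rw [integral_add (hh.1.integrable.const_mul _)
      (hh.1.integrable_mul (f := fun x => x) (integrable_Ioo_of_continuousOn continuousOn_id)),
      integral_const_mul, hh.2]
    simp
  · rintro _ ⟨v, g, hv, h0, hm, rfl⟩
    obtain ⟨c, hc⟩ := hv.ae_eq_prim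
    have hpos : 0 < ∫ x in Ioo (0 : ℝ) 1, v x ^ 2 * h x :=
      integral_sq_mul_pos (fun x hx => hh.1.pos hx) (hh.1.integrable_mul hv.1.integrable_sq) h0
    rw [le_div_iff₀ hpos, integral_congr_ae (hc.mono fun x hx => by
      show v x ^ 2 * h x = (c + prim g x) ^ 2 * h x
      rw [hx])]
    refine H g c hv.2.1 (Eq.trans (integral_congr_ae (hc.mono fun x hx => ?_)) hm)
    show _ = v x * h x
    rw [hx]

/-! ### Transplantation and the upper bound. -/

/-- Transplantation: composing a Steklov test function with the primitive of `h` gives a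
Neumann test function. -/
lemma mu1_mul_le_comp {h : ℝ → ℝ} (hh : IsUnitProfile h) {g : ℝ → ℝ} (hg : MemLp g 2 ν) {c : ℝ}
    (hm : ∫ x in Ioo (0 : ℝ) 1, (c + prim g x) = 0) :
    mu1 h * ∫ x in Ioo (0 : ℝ) 1, (c + prim g x) ^ 2 ≤
      ∫ x in Ioo (0 : ℝ) 1, (h x * g (prim h x)) ^ 2 * h x := by
  have := mu1_mul_le hh (hh.memLp_comp hg) c
  have e1 : ∫ x in Ioo (0 : ℝ) 1, (c + prim (fun t => h t * g (prim h t)) x) * h x = 0 := by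
    refine Eq.trans (setIntegral_congr_fun measurableSet_Ioo fun x hx => ?_)
      ((hh.integral_comp _).symm.trans hm)
    simp only [hh.prim_comp g (Ioo_subset_Icc_self hx), mul_comm]
  have e2 : ∫ x in Ioo (0 : ℝ) 1, (c + prim (fun t => h t * g (prim h t)) x) ^ 2 * h x =
      ∫ x in Ioo (0 : ℝ) 1, (c + prim g x) ^ 2 := by
    refine Eq.trans (setIntegral_congr_fun measurableSet_Ioo fun x hx => ?_)
      (hh.integral_comp _).symm
    simp only [hh.prim_comp g (Ioo_subset_Icc_self hx), mul_comm]
  rw [e1, e2] at this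
  simpa using this

/-- The transplanted energy loses at least the deficit in `h ^ 2 ≤ 2 * h ∘ prim h`. -/
lemma integral_comp_energy {h : ℝ → ℝ} (hh : IsUnitProfile h) {g : ℝ → ℝ} (hg : MemLp g 2 ν) :
    ∫ x in Ioo (0 : ℝ) 1, (h x * g (prim h x)) ^ 2 * h x =
      2 * (∫ x in Ioo (0 : ℝ) 1, g x ^ 2 * h x) -
      ∫ x in Ioo (0 : ℝ) 1, h x * g (prim h x) ^ 2 * (2 * h (prim h x) - h x ^ 2) := by
  have i1 : Integrable (fun x => h x * (g (prim h x) ^ 2 * h (prim h x))) ν :=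
    (hh.integrable_comp_iff (fun x => g x ^ 2 * h x)).1 (hh.1.integrable_mul hg.integrable_sq)
  have i2 := hh.1.integrable_mul (hh.memLp_comp hg).integrable_sq
  rw [hh.integral_comp (fun x => g x ^ 2 * h x), ← integral_const_mul, ← integral_sub]
  · congr 1; funext x; ring
  · exact i1.const_mul 2
  · refine ((i1.const_mul 2).sub i2).congr (Eventually.of_forall fun x => ?_)
    simp only [Pi.sub_apply]
    ring

theorem mu1_le_two_mul_sigma1 {h : ℝ → ℝ} (hh : IsUnitProfile h) : mu1 h ≤ 2 * sigma1 h := by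
  have : mu1 h / 2 ≤ sigma1 h := by
    refine le_sigma1 fun g c hg hm => ?_
    have h1 := mu1_mul_le_comp hh hg hm
    rw [integral_comp_energy hh hg] at h1
    have h2 : 0 ≤ ∫ x in Ioo (0 : ℝ) 1, h x * g (prim h x) ^ 2 * (2 * h (prim h x) - h x ^ 2) :=
      setIntegral_nonneg measurableSet_Ioo fun x hx =>
        mul_nonneg (mul_nonneg (hh.1.pos hx).le (sq_nonneg _)) (sub_nonneg.2 (hh.sq_le hx))
    linarith
  linarith

/-! ### Positivity of the Steklov eigenvalue. -/

lemma intervalIntegral_sq_le {v : ℝ → ℝ} (hv : MemLp v 2 ν) {a b : ℝ} (ha : 0 ≤ a) (hab : a ≤ b)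
    (hb : b ≤ 1) : (∫ t in a..b, v t) ^ 2 ≤ (b - a) * ∫ x in Ioo (0 : ℝ) 1, v x ^ 2 := by
  rcases hab.eq_or_lt with rfl | hab'
  · simp
  have ma : a ∈ Icc (0 : ℝ) 1 := ⟨ha, hab.trans hb⟩
  have mb : b ∈ Icc (0 : ℝ) 1 := ⟨ha.trans hab, hb⟩
  have i1 := intervalIntegrable_sub hv.integrable_Ioo ma mb
  have i2 := intervalIntegrable_sub hv.integrable_sq ma mb
  set p := ∫ t in a..b, v t with hp
  -- Cauchy–Schwarz on [a,b], as non-negativity of the variance about the mean p/(b - a).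
  have h0 : 0 ≤ ∫ t in a..b, (v t - p / (b - a)) ^ 2 :=
    intervalIntegral.integral_nonneg hab fun _ _ => sq_nonneg _
  have e : ∀ t, (v t - p / (b - a)) ^ 2 =
      v t ^ 2 - (2 * (p / (b - a))) * v t + (p / (b - a)) ^ 2 := fun t => by ring
  simp only [e] at h0
  rw [intervalIntegral.integral_add (i2.sub (i1.const_mul _)) (by simp),
    intervalIntegral.integral_sub i2 (i1.const_mul _), intervalIntegral.integral_const_mul, ← hp,
    intervalIntegral.integral_const] at h0
  have hle : ∫ t in a..b, v t ^ 2 ≤ ∫ x in Ioo (0 : ℝ) 1, v x ^ 2 := by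
    rw [intervalIntegral.integral_of_le hab, integral_Ioc_eq_integral_Ioo]
    exact setIntegral_mono_set hv.integrable_sq (Eventually.of_forall fun _ => sq_nonneg _)
      (Ioo_subset_Ioo ha hb).eventuallyLE
  have hba : 0 < b - a := sub_pos.2 hab'
  have e2 : (2 * (p / (b - a))) * p - (b - a) • (p / (b - a)) ^ 2 = p ^ 2 / (b - a) := by
    simp only [smul_eq_mul]; field_simp; ring
  have h3 : p ^ 2 / (b - a) ≤ ∫ x in Ioo (0 : ℝ) 1, v x ^ 2 := by linarith
  rw [div_le_iff₀ hba] at h3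
  linarith

/-- `prim v` vanishes at both ends, so Cauchy–Schwarz from the nearer end gives the factor min(x, 1
- x) ≤ 2x(1 - x). -/
lemma prim_sq_le_of_integral_eq_zero {v : ℝ → ℝ} (hv : MemLp v 2 ν)
    (hm : ∫ x in Ioo (0 : ℝ) 1, v x = 0) {x : ℝ} (hx : x ∈ Ioo (0 : ℝ) 1) :
    prim v x ^ 2 ≤ 2 * (x * (1 - x)) * ∫ x in Ioo (0 : ℝ) 1, v x ^ 2 := by
  have hD := integral_sq_nonneg_Ioo v
  have h1 : prim v x ^ 2 ≤ (x - 0) * ∫ x in Ioo (0 : ℝ) 1, v x ^ 2 :=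
    intervalIntegral_sq_le hv le_rfl hx.1.le hx.2.le
  have h2 := intervalIntegral_sq_le hv hx.1.le hx.2.le le_rfl
  rw [← prim_sub hv.integrable_Ioo (Ioo_subset_Icc_self hx) (by simp), prim_one, hm, zero_sub,
    neg_sq] at h2
  have h3 := mul_nonneg hD hx.1.le
  have h4 := mul_nonneg hD (sub_pos.2 hx.2).le
  rcases le_total x (1 / 2) with h | h
  · nlinarith
  · nlinarith

/-- The weight x(1 - x) cancels, so the quotient stays bounded even where h vanishes at an endpoint.
-/
lemma prim_sq_div_le {h : ℝ → ℝ} (hh : IsProfile h) {v : ℝ → ℝ} (hv : MemLp v 2 ν)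
    (hm : ∫ x in Ioo (0 : ℝ) 1, v x = 0) {x : ℝ} (hx : x ∈ Ioo (0 : ℝ) 1) :
    prim v x ^ 2 / h x ≤ 2 / h (1 / 2) * ∫ x in Ioo (0 : ℝ) 1, v x ^ 2 := by
  have hD := integral_sq_nonneg_Ioo v
  have hp := hh.half_pos
  rw [div_le_iff₀ (hh.pos hx)]
  refine (prim_sq_le_of_integral_eq_zero hv hm hx).trans ?_
  have := mul_le_mul_of_nonneg_left (hh.lower_bound hx)
    (mul_nonneg (div_pos two_pos hp).le hD)
  refine le_trans (le_of_eq ?_) this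
  field_simp

lemma integrable_prim_sq_div {h : ℝ → ℝ} (hh : IsProfile h) {v : ℝ → ℝ} (hv : MemLp v 2 ν)
    (hm : ∫ x in Ioo (0 : ℝ) 1, v x = 0) : Integrable (fun x => prim v x ^ 2 / h x) ν := by
  have hm' : AEStronglyMeasurable (fun x => prim v x ^ 2 / h x) ν := by
    refine ContinuousOn.aestronglyMeasurable ?_ measurableSet_Ioo
    exact (((continuousOn_prim hv.integrable_Ioo).mono Ioo_subset_Icc_self).pow 2).div
      hh.continuousOn fun x hx => (hh.pos hx).ne'
  refine Integrable.of_bound hm' (2 / h (1 / 2) * ∫ x in Ioo (0 : ℝ) 1, v x ^ 2) ?_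
  rw [ae_restrict_iff' measurableSet_Ioo]
  refine Eventually.of_forall fun x hx => ?_
  rw [Real.norm_of_nonneg (div_nonneg (sq_nonneg _) (hh.pos hx).le)]
  exact prim_sq_div_le hh hv hm hx

/-- Integration by parts; the boundary terms vanish because the primitive of a mean-zero function is
0 at both ends. -/
lemma integral_sq_eq_neg {g : ℝ → ℝ} (hg : MemLp g 2 ν) {c : ℝ}
    (hm : ∫ x in Ioo (0 : ℝ) 1, (c + prim g x) = 0) :
    ∫ x in Ioo (0 : ℝ) 1, (c + prim g x) ^ 2 =
      -∫ x in Ioo (0 : ℝ) 1, g x * prim (fun x => c + prim g x) x := by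
  have := integral_prim_mul hg.integrable_Ioo
    (integrable_Ioo_of_continuousOn (continuousOn_const_add_prim hg c)) c 0
  rw [prim_one (fun x => c + prim g x), hm] at this
  simpa [sq] using this

/-- Cauchy–Schwarz in the form of a weighted arithmetic–geometric mean inequality. -/
lemma two_mul_integral_sq_le {h : ℝ → ℝ} (hh : IsProfile h) {g : ℝ → ℝ} (hg : MemLp g 2 ν) {c : ℝ}
    (hm : ∫ x in Ioo (0 : ℝ) 1, (c + prim g x) = 0) {A : ℝ} (hA : 0 < A) :
    2 * ∫ x in Ioo (0 : ℝ) 1, (c + prim g x) ^ 2 ≤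
      A * (∫ x in Ioo (0 : ℝ) 1, g x ^ 2 * h x) +
      A⁻¹ * ∫ x in Ioo (0 : ℝ) 1, prim (fun x => c + prim g x) x ^ 2 / h x := by
  have hv := memLp_prim hg.integrable_Ioo c 2
  have hpc : ContinuousOn (prim (fun x => c + prim g x)) (Icc 0 1) :=
    continuousOn_prim hv.integrable_Ioo
  have i1 := (hh.integrable_mul hg.integrable_sq).const_mul A
  have i2 := (integrable_prim_sq_div hh hv hm).const_mul A⁻¹
  have i3 : Integrable (fun x => g x * prim (fun x => c + prim g x) x) ν := by
    obtain ⟨C, hC⟩ := isCompact_Icc.exists_bound_of_continuousOn hpc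
    refine hg.integrable_Ioo.mul_bdd (c := C)
      ((hpc.mono Ioo_subset_Icc_self).aestronglyMeasurable measurableSet_Ioo) ?_
    rw [ae_restrict_iff' measurableSet_Ioo]
    exact Eventually.of_forall fun x hx => hC x (Ioo_subset_Icc_self hx)
  rw [integral_sq_eq_neg hg hm, ← integral_const_mul, ← integral_const_mul,
    ← integral_add i1 i2, ← integral_neg, ← integral_const_mul]
  refine setIntegral_mono_on (i3.neg.const_mul 2) (i1.add i2) measurableSet_Ioo fun x hx => ?_
  have hp := hh.pos hx
  set p := prim (fun x => c + prim g x) x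
  have : 0 ≤ (A * h x * g x + p) ^ 2 / (A * h x) := by positivity
  have e : (A * h x * g x + p) ^ 2 / (A * h x) =
    A * (g x ^ 2 * h x) + A⁻¹ * (p ^ 2 / h x) + 2 * (g x * p) := by field_simp; ring
  linarith

theorem sigma1_pos {h : ℝ → ℝ} (hh : IsProfile h) : 0 < sigma1 h := by
  have hp := hh.half_pos
  refine (half_pos hp).trans_le (le_sigma1 fun g c hg hm => ?_)
  have hv := memLp_prim hg.integrable_Ioo c 2
  -- This A makes the last term at most ∫ v², which is absorbed on the left, leaving σ₁ ≥ h(1/2)/2.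
  have h1 := two_mul_integral_sq_le hh hg hm (A := 2 / h (1 / 2)) (by positivity)
  have h2 : ∫ x in Ioo (0 : ℝ) 1, prim (fun x => c + prim g x) x ^ 2 / h x ≤
      ∫ x in Ioo (0 : ℝ) 1, (2 / h (1 / 2) * ∫ x in Ioo (0 : ℝ) 1, (c + prim g x) ^ 2) :=
    setIntegral_mono_on (integrable_prim_sq_div hh hv hm) (integrable_const _) measurableSet_Ioo
      fun x hx => prim_sq_div_le hh hv hm hx
  rw [integral_Ioo_const] at h2
  set D := ∫ x in Ioo (0 : ℝ) 1, (c + prim g x) ^ 2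
  have h3 := mul_le_mul_of_nonneg_left h2 (a := (2 / h (1 / 2))⁻¹) (by positivity)
  have e : (2 / h (1 / 2))⁻¹ * (2 / h (1 / 2) * D) = D := by field_simp
  rw [e] at h3
  have h4 : D ≤ 2 / h (1 / 2) * ∫ x in Ioo (0 : ℝ) 1, g x ^ 2 * h x := by linarith
  have h5 := mul_le_mul_of_nonneg_left h4 (a := h (1 / 2) / 2) (by positivity)
  refine h5.trans (le_of_eq ?_)
  field_simp

/-! ### Monotone competitors, Harnack inequality and inverse iteration. -/

lemma prim_mono_of_nonneg {g : ℝ → ℝ} (hg : Integrable g ν) (h0 : ∀ x, 0 ≤ g x) :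
    MonotoneOn (prim g) (Icc 0 1) := by
  intro x hx y hy hxy
  have := prim_sub hg hx hy
  have h1 : 0 ≤ ∫ t in x..y, g t := intervalIntegral.integral_nonneg hxy fun t _ => h0 t
  linarith

lemma abs_prim_sub_le {g : ℝ → ℝ} (hg : Integrable g ν) {x y : ℝ} (hx : x ∈ Icc (0 : ℝ) 1)
    (hy : y ∈ Icc (0 : ℝ) 1) :
    |prim g y - prim g x| ≤ |prim (fun t => |g t|) y - prim (fun t => |g t|) x| := by
  rw [prim_sub hg hx hy, prim_sub hg.abs hx hy]
  exact intervalIntegral.norm_integral_le_abs_integral_norm (f := g) (μ := volume)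

lemma integral_sq_le_integral_sub_sq {v : ℝ → ℝ} (hv : ContinuousOn v (Icc 0 1))
    (hm : ∫ x in Ioo (0 : ℝ) 1, v x = 0) (a : ℝ) :
    ∫ x in Ioo (0 : ℝ) 1, v x ^ 2 ≤ ∫ x in Ioo (0 : ℝ) 1, (v x - a) ^ 2 := by
  have i1 := integrable_Ioo_of_continuousOn hv
  have i2 : Integrable (fun x => v x ^ 2) ν := integrable_Ioo_of_continuousOn (hv.pow 2)
  have i3 : Integrable (fun x => v x ^ 2 - (2 * a) * v x) ν := i2.sub (i1.const_mul _)
  have e : ∀ x, (v x - a) ^ 2 = v x ^ 2 - (2 * a) * v x + a ^ 2 := fun x => by ring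
  simp only [e]
  rw [integral_add i3 (integrable_const _), integral_sub i2 (i1.const_mul _), integral_const_mul,
    hm, integral_Ioo_const]
  nlinarith [sq_nonneg a]

lemma integral_const_add_prim {g : ℝ → ℝ} (hg : MemLp g 2 ν) (c : ℝ) :
    ∫ x in Ioo (0 : ℝ) 1, (c + prim g x) = c + ∫ x in Ioo (0 : ℝ) 1, prim g x := by
  rw [integral_add (integrable_const _)
    (integrable_Ioo_of_continuousOn (continuousOn_prim hg.integrable_Ioo)), integral_Ioo_const]

/-- Replacing the derivative of a mean-zero function by its absolute value and recentring does
not decrease the `L²` norm. -/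
lemma exists_monotone_rearrangement {g : ℝ → ℝ} (hg : MemLp g 2 ν) {c : ℝ}
    (hm : ∫ x in Ioo (0 : ℝ) 1, (c + prim g x) = 0) :
    ∃ d, ∫ x in Ioo (0 : ℝ) 1, (d + prim (fun t => |g t|) x) = 0 ∧
      ∫ x in Ioo (0 : ℝ) 1, (c + prim g x) ^ 2 ≤
        ∫ x in Ioo (0 : ℝ) 1, (d + prim (fun t => |g t|) x) ^ 2 := by
  have hg' : MemLp (fun t => |g t|) 2 ν := hg.abs
  have hc' := continuousOn_prim hg'.integrable_Ioo
  have hmono := prim_mono_of_nonneg hg'.integrable_Ioo fun t => abs_nonneg (g t)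
  set d := -∫ x in Ioo (0 : ℝ) 1, prim (fun t => |g t|) x with hd
  have hi := integrable_Ioo_of_continuousOn hc'
  have h0 : d + prim (fun t => |g t|) 0 ≤ 0 := by
    rw [prim_zero, hd, add_zero, neg_nonpos]
    refine setIntegral_nonneg measurableSet_Ioo fun x hx => ?_
    have := hmono (by simp) (Ioo_subset_Icc_self hx) hx.1.le
    rwa [prim_zero] at this
  have h1 : 0 ≤ d + prim (fun t => |g t|) 1 := by
    have : ∫ x in Ioo (0 : ℝ) 1, prim (fun t => |g t|) x ≤
        ∫ x in Ioo (0 : ℝ) 1, prim (fun t => |g t|) 1 :=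
      setIntegral_mono_on hi (integrable_const _) measurableSet_Ioo fun x hx =>
        hmono (Ioo_subset_Icc_self hx) (by simp) hx.2.le
    rw [integral_Ioo_const] at this
    linarith
  -- Let z be a zero of the monotone competitor. Increments from z only grow when g is replaced by
  -- |g|, and a mean-zero v has ∫ v² ≤ ∫ (v - v(z))².
  obtain ⟨z, hz, hz0⟩ := intermediate_value_Icc (zero_le_one' ℝ)
    (continuousOn_const_add_prim hg' d) ⟨h0, h1⟩
  refine ⟨d, by rw [integral_const_add_prim hg', hd]; ring, ?_⟩
  refine (integral_sq_le_integral_sub_sq (continuousOn_const_add_prim hg c) hm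
    (c + prim g z)).trans ?_
  refine setIntegral_mono_on
    (integrable_Ioo_of_continuousOn (((continuousOn_const_add_prim hg c).sub
      continuousOn_const).pow 2))
    (integrable_Ioo_of_continuousOn ((continuousOn_const_add_prim hg' d).pow 2))
    measurableSet_Ioo fun x hx => ?_
  have := abs_prim_sub_le hg.integrable_Ioo hz (Ioo_subset_Icc_self hx)
  have e1 : c + prim g x - (c + prim g z) = prim g x - prim g z := by ring
  have e2 : d + prim (fun t => |g t|) x = prim (fun t => |g t|) x - prim (fun t => |g t|) z := by
    simp only at hz0
    linarith
  rw [e1, e2]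
  exact sq_le_sq.2 this

lemma hasDerivAt_prim_of_continuousOn {v : ℝ → ℝ} (hv : ContinuousOn v (Icc 0 1)) {x : ℝ}
    (hx : x ∈ Ioo (0 : ℝ) 1) : HasDerivAt (prim v) (v x) x :=
  intervalIntegral.integral_hasDerivAt_right
    (intervalIntegrable_sub (integrable_Ioo_of_continuousOn hv) (by simp) (Ioo_subset_Icc_self hx))
    ((hv.mono Ioo_subset_Icc_self).stronglyMeasurableAtFilter isOpen_Ioo x hx)
    ((hv.mono Ioo_subset_Icc_self).continuousAt (Ioo_mem_nhds hx.1 hx.2))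

lemma concaveOn_neg_prim {v : ℝ → ℝ} (hv : ContinuousOn v (Icc 0 1))
    (hmono : MonotoneOn v (Icc 0 1)) : ConcaveOn ℝ (Icc 0 1) fun x => -prim v x := by
  have hd : ∀ x ∈ Ioo (0 : ℝ) 1, HasDerivAt (fun x => -prim v x) (-v x) x := fun x hx =>
    (hasDerivAt_prim_of_continuousOn hv hx).neg
  refine AntitoneOn.concaveOn_of_deriv (convex_Icc _ _)
    (continuousOn_prim (integrable_Ioo_of_continuousOn hv)).neg ?_ ?_
  · rw [interior_Icc]
    exact fun x hx => (hd x hx).differentiableAt.differentiableWithinAt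
  · rw [interior_Icc]
    intro x hx y hy hxy
    rw [(hd x hx).deriv, (hd y hy).deriv]
    exact neg_le_neg (hmono (Ioo_subset_Icc_self hx) (Ioo_subset_Icc_self hy) hxy)

lemma neg_prim_nonneg {v : ℝ → ℝ} (hv : ContinuousOn v (Icc 0 1))
    (hmono : MonotoneOn v (Icc 0 1)) (hm : ∫ x in Ioo (0 : ℝ) 1, v x = 0) {x : ℝ}
    (hx : x ∈ Ioo (0 : ℝ) 1) : 0 ≤ -prim v x := by
  have m0 : (0 : ℝ) ∈ Icc (0 : ℝ) 1 := by simp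
  have m1 : (1 : ℝ) ∈ Icc (0 : ℝ) 1 := by simp
  have ha : 0 ≤ 1 - x := (sub_pos.2 hx.2).le
  have := (concaveOn_neg_prim hv hmono).2 m0 m1 ha hx.1.le (by ring)
  simpa [prim_zero, prim_one, hm] using this

/-- A non-negative concave P satisfies P(x) ≥ min(x/y, (1 - x)/(1 - y)) P(y), and both ratios are at
least x(1 - x). -/
lemma neg_prim_harnack {v : ℝ → ℝ} (hv : ContinuousOn v (Icc 0 1))
    (hmono : MonotoneOn v (Icc 0 1)) (hm : ∫ x in Ioo (0 : ℝ) 1, v x = 0) {x y : ℝ}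
    (hx : x ∈ Ioo (0 : ℝ) 1) (hy : y ∈ Ioo (0 : ℝ) 1) :
    x * (1 - x) * -prim v y ≤ -prim v x := by
  have hc := (concaveOn_neg_prim hv hmono).subset Ioo_subset_Icc_self (convex_Ioo _ _)
  have h0 : ∀ x ∈ Ioo (0 : ℝ) 1, 0 ≤ -prim v x := fun x hx => neg_prim_nonneg hv hmono hm hx
  have a := h0 x hx
  have b := h0 y hy
  have hx1 := hx.1
  have hx2 := sub_pos.2 hx.2
  rcases le_total x y with h | h
  · have := hc.mul_le_mul_of_nonneg_Ioo h0 hx.1 h hy.2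
    have t1 := mul_nonneg (sub_pos.2 hy.2).le a
    have t2 := mul_nonneg (mul_nonneg hx1.le hx1.le) b
    nlinarith
  · have := hc.one_sub_mul_le_mul_of_nonneg_Ioo h0 hy.1 h hx.2
    have t1 := mul_nonneg hy.1.le a
    have t2 := mul_nonneg (mul_nonneg hx2.le hx2.le) b
    nlinarith

/-- The quotient is bounded: v is bounded and `prim v` vanishes at both ends, so |`prim v`| ≤ 2C x(1
- x), which h dominates up to a constant. -/
lemma memLp_prim_div {h : ℝ → ℝ} (hh : IsProfile h) {v : ℝ → ℝ} (hv : ContinuousOn v (Icc 0 1))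
    (hm : ∫ x in Ioo (0 : ℝ) 1, v x = 0) : MemLp (fun x => -prim v x / h x) 2 ν := by
  have hi := integrable_Ioo_of_continuousOn hv
  have hmeas : AEStronglyMeasurable (fun x => -prim v x / h x) ν := by
    refine ContinuousOn.aestronglyMeasurable ?_ measurableSet_Ioo
    exact ((continuousOn_prim hi).mono Ioo_subset_Icc_self).neg.div
      hh.continuousOn fun x hx => (hh.pos hx).ne'
  obtain ⟨C, hC⟩ := isCompact_Icc.exists_bound_of_continuousOn hv
  have hC0 : 0 ≤ C := (norm_nonneg _).trans (hC 0 (by simp))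
  have hp := hh.half_pos
  refine MemLp.of_bound hmeas (2 * C / h (1 / 2)) ?_
  rw [ae_restrict_iff' measurableSet_Ioo]
  refine Eventually.of_forall fun x hx => ?_
  have hb : ∀ a ∈ Icc (0 : ℝ) 1, ∀ b ∈ Icc (0 : ℝ) 1, a ≤ b → |prim v b - prim v a| ≤ C * (b - a) := by
    intro a ha b hb hab
    rw [prim_sub hi ha hb]
    have := intervalIntegral.norm_integral_le_of_norm_le_const (f := v) (a := a) (b := b) (C := C)
      (fun t ht => by
        rw [uIoc_of_le hab] at ht
        exact hC t ⟨ha.1.trans ht.1.le, ht.2.trans hb.2⟩)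
    rwa [abs_of_nonneg (sub_nonneg.2 hab)] at this
  have h1 := hb 0 (by simp) x (Ioo_subset_Icc_self hx) hx.1.le
  have h2 := hb x (Ioo_subset_Icc_self hx) 1 (by simp) hx.2.le
  rw [prim_zero, sub_zero, sub_zero] at h1
  rw [prim_one, hm, zero_sub, abs_neg] at h2
  have hpx := hh.pos hx
  rw [norm_div, norm_neg, Real.norm_eq_abs, Real.norm_of_nonneg hpx.le, div_le_div_iff₀ hpx hp]
  have h3 : |prim v x| ≤ 2 * C * (x * (1 - x)) := by
    have t1 := mul_nonneg hC0 hx.1.le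
    have t2 := mul_nonneg hC0 (sub_pos.2 hx.2).le
    rcases le_total x (1 / 2) with h | h <;> nlinarith
  calc |prim v x| * h (1 / 2) ≤ 2 * C * (x * (1 - x)) * h (1 / 2) :=
        mul_le_mul_of_nonneg_right h3 hp.le
    _ = 2 * C * (h (1 / 2) * (x * (1 - x))) := by ring
    _ ≤ 2 * C * h x := mul_le_mul_of_nonneg_left (hh.lower_bound hx) (by positivity)

lemma two_mul_integral_mul_le {u v : ℝ → ℝ} (hu : ContinuousOn u (Icc 0 1))
    (hv : ContinuousOn v (Icc 0 1)) {A : ℝ} (hA : 0 < A) :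
    2 * ∫ x in Ioo (0 : ℝ) 1, u x * v x ≤
      A * (∫ x in Ioo (0 : ℝ) 1, u x ^ 2) + A⁻¹ * ∫ x in Ioo (0 : ℝ) 1, v x ^ 2 := by
  have i1 : Integrable (fun x => A * u x ^ 2) ν :=
    (integrable_Ioo_of_continuousOn (hu.pow 2)).const_mul A
  have i2 : Integrable (fun x => A⁻¹ * v x ^ 2) ν :=
    (integrable_Ioo_of_continuousOn (hv.pow 2)).const_mul A⁻¹
  have i3 : Integrable (fun x => 2 * (u x * v x)) ν :=
    (integrable_Ioo_of_continuousOn (hu.mul hv)).const_mul 2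
  rw [← integral_const_mul, ← integral_const_mul, ← integral_const_mul, ← integral_add i1 i2]
  refine integral_mono i3 (i1.add i2) fun x => ?_
  have : 0 ≤ (A * u x - v x) ^ 2 / A := by positivity
  have e : (A * u x - v x) ^ 2 / A = A * u x ^ 2 + A⁻¹ * v x ^ 2 - 2 * (u x * v x) := by
    field_simp; ring
  linarith

/-- One step of inverse iteration: the mean-zero function with derivative `-prim v / h` has
a smaller Rayleigh quotient than `v`. -/
lemma inverse_iteration {h : ℝ → ℝ} (hh : IsProfile h) {g : ℝ → ℝ} (hg : MemLp g 2 ν) {c : ℝ}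
    (hm : ∫ x in Ioo (0 : ℝ) 1, (c + prim g x) = 0)
    (hD : 0 < ∫ x in Ioo (0 : ℝ) 1, (c + prim g x) ^ 2) :
    (∫ x in Ioo (0 : ℝ) 1, (c + prim g x) ^ 2) ^ 2 ≤
      (∫ x in Ioo (0 : ℝ) 1, g x ^ 2 * h x) *
        ∫ x in Ioo (0 : ℝ) 1, prim (fun x => c + prim g x) x ^ 2 / h x ∧
    ∃ d, ∫ x in Ioo (0 : ℝ) 1, (d + prim (fun t => -prim (fun x => c + prim g x) t / h t) x) = 0 ∧
      (∫ x in Ioo (0 : ℝ) 1, prim (fun x => c + prim g x) x ^ 2 / h x) ^ 2 ≤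
        (∫ x in Ioo (0 : ℝ) 1, (d + prim (fun t => -prim (fun x => c + prim g x) t / h t) x) ^ 2) *
        ∫ x in Ioo (0 : ℝ) 1, (c + prim g x) ^ 2 := by
  have hv := continuousOn_const_add_prim hg c
  have hW := memLp_prim_div hh hv hm
  set W := fun t => -prim (fun x => c + prim g x) t / h t with hWdef
  have hs := sigma1_mul_le hh hg c
  rw [hm] at hs
  have hsp := sigma1_pos hh
  have hAM := fun {A : ℝ} (hA : 0 < A) => two_mul_integral_sq_le hh hg hm hA
  set R := ∫ x in Ioo (0 : ℝ) 1, prim (fun x => c + prim g x) x ^ 2 / h x with hR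
  set E := ∫ x in Ioo (0 : ℝ) 1, g x ^ 2 * h x
  set D := ∫ x in Ioo (0 : ℝ) 1, (c + prim g x) ^ 2
  have hE : 0 < E := by
    refine lt_of_lt_of_le (mul_pos hsp hD) (le_trans (le_of_eq ?_) hs)
    ring
  have h1 : D ^ 2 ≤ E * R := by
    -- A = D/E balances the two terms and recovers D² ≤ E R.
    have := hAM (div_pos hD hE)
    have e1 : D / E * E = D := by field_simp
    have e2 : (D / E)⁻¹ * R = E * R / D := by field_simp
    rw [e1, e2] at this
    have h3 : D ≤ E * R / D := by linarith
    rw [le_div_iff₀ hD] at h3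
    linarith
  refine ⟨h1, -∫ x in Ioo (0 : ℝ) 1, prim W x, by rw [integral_const_add_prim hW]; ring, ?_⟩
  set d := -∫ x in Ioo (0 : ℝ) 1, prim W x
  have hRpos : 0 < R := pos_of_mul_pos_right (lt_of_lt_of_le (by positivity) h1) hE.le
  -- With w = d + `prim W`, so that -(h w')' = v, this yields ∫ w v = R, which is also the energy ∫
  -- W² h. Cauchy–Schwarz then gives R² ≤ D' D.
  have hparts := integral_prim_mul hW.integrable_Ioo (integrable_Ioo_of_continuousOn hv) d 0
  rw [prim_one (fun x => c + prim g x), hm] at hparts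
  have e : ∫ x in Ioo (0 : ℝ) 1, W x * (0 + prim (fun x => c + prim g x) x) = -R := by
    rw [hR, ← integral_neg]
    congr 1; funext x
    simp only [hWdef]
    ring
  rw [e] at hparts
  have h2 := two_mul_integral_mul_le (continuousOn_const_add_prim hW d) hv (div_pos hD hRpos)
  rw [hparts] at h2
  set D' := ∫ x in Ioo (0 : ℝ) 1, (d + prim W x) ^ 2
  have e1 : (D / R)⁻¹ * D = R := by field_simp
  have e2 : D / R * D' = D' * D / R := by field_simp
  have h3 : R ≤ D' * D / R := by
    change 2 * _ ≤ D / R * D' + (D / R)⁻¹ * D at h2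
    rw [e1, e2] at h2
    linarith
  rw [le_div_iff₀ hRpos] at h3
  linarith

/-! ### Strict inequality away from triangles. -/

/-- Integrals of bounded functions, split into the bulk `(δ, 1 - δ)` and the boundary layers. -/
lemma integral_le_of_bulk_bound {F : ℝ → ℝ} (hF : Integrable F ν) {δ B K : ℝ} (h0 : 0 < δ)
    (h1 : δ < 1 / 2) (hB : 0 ≤ B) (hb : ∀ x ∈ Ioo δ (1 - δ), F x ≤ B)
    (hk : ∀ x ∈ Ioo (0 : ℝ) 1, F x ≤ K) : ∫ x in Ioo (0 : ℝ) 1, F x ≤ B + 2 * δ * K := by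
  have hi : Integrable (fun x => B + K - (Ioo δ (1 - δ)).indicator (fun _ => K) x) ν :=
    (integrable_const _).sub ((integrable_const _).indicator measurableSet_Ioo)
  have h2 : ∫ x in Ioo (0 : ℝ) 1, F x ≤
      ∫ x in Ioo (0 : ℝ) 1, (B + K - (Ioo δ (1 - δ)).indicator (fun _ => K) x) := by
    refine setIntegral_mono_on hF hi measurableSet_Ioo fun x hx => ?_
    by_cases hx' : x ∈ Ioo δ (1 - δ)
    · rw [indicator_of_mem hx']; linarith [hb x hx']
    · rw [indicator_of_notMem hx']; linarith [hk x hx]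
  refine h2.trans (le_of_eq ?_)
  rw [integral_sub (integrable_const _) ((integrable_const _).indicator measurableSet_Ioo),
    integral_Ioo_const, setIntegral_indicator measurableSet_Ioo,
    inter_eq_self_of_subset_right (Ioo_subset_Ioo h0.le (by linarith))]
  rw [setIntegral_const, Real.volume_real_Ioo_of_le (by linarith), smul_eq_mul]
  ring

/-- After one step of inverse iteration, the energy of a near-optimal monotone function is not
concentrated near the boundary. -/
lemma exists_energy_lower_bound {h : ℝ → ℝ} (hh : IsProfile h) {α β : ℝ} (hα : 0 < α)
    (hαβ : α < β) (hβ : β < 1) :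
    ∃ κ : ℝ, 0 < κ ∧ ∀ (g : ℝ → ℝ) (c : ℝ), MemLp g 2 ν → (∀ x, 0 ≤ g x) →
      ∫ x in Ioo (0 : ℝ) 1, (c + prim g x) = 0 →
      0 < ∫ x in Ioo (0 : ℝ) 1, (c + prim g x) ^ 2 →
      ∫ x in Ioo (0 : ℝ) 1, g x ^ 2 * h x ≤
        (sigma1 h + 1) * ∫ x in Ioo (0 : ℝ) 1, (c + prim g x) ^ 2 →
      κ * ∫ x in Ioo (0 : ℝ) 1, prim (fun x => c + prim g x) x ^ 2 / h x ≤
        ∫ x in Ioo α β, (-prim (fun x => c + prim g x) x / h x) ^ 2 := by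
  have hp := hh.half_pos
  have hσ := sigma1_pos hh
  set q := h (1 / 2) with hq
  set s := sigma1 h + 1 with hs
  have hs0 : 0 < s := by linarith
  -- δ is so small that the boundary layers contribute at most D/(2s) to R, half of the lower bound
  -- D/s proved below.
  obtain ⟨δ, hδ0, hδ1, hδ2⟩ : ∃ δ : ℝ, 0 < δ ∧ δ < 1 / 2 ∧ 2 * δ * (2 / q) ≤ 1 / (2 * s) := by
    refine ⟨min (1 / 4) (q / (8 * s)), lt_min (by norm_num) (by positivity),
      (min_le_left _ _).trans_lt (by norm_num), ?_⟩
    have h1 := mul_le_mul_of_nonneg_right (min_le_right (1 / 4) (q / (8 * s)))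
      (by positivity : 0 ≤ 4 / q)
    have e : q / (8 * s) * (4 / q) = 1 / (2 * s) := by field_simp; norm_num
    rw [e] at h1
    refine le_trans (le_of_eq ?_) h1
    ring
  have hδ' : 0 < 1 - δ := by linarith
  set θ := α * (1 - β) with hθ
  have hθ0 : 0 < θ := mul_pos hα (sub_pos.2 hβ)
  set κ' := θ ^ 2 * (q * (δ * (1 - δ))) * q / (4 * s) with hκ'
  have hκ'0 : 0 < κ' := by positivity
  refine ⟨(β - α) * (κ' / (2 * q) ^ 2), mul_pos (sub_pos.2 hαβ) (by positivity), ?_⟩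
  intro g c hg hg0 hm hD hE
  have hv := continuousOn_const_add_prim hg c
  have hmono : MonotoneOn (fun x => c + prim g x) (Icc 0 1) := fun x hx y hy hxy =>
    add_le_add_right (prim_mono_of_nonneg hg.integrable_Ioo hg0 hx hy hxy) c
  have hv2 := memLp_prim hg.integrable_Ioo c 2
  have hharn := fun {x y : ℝ} => @neg_prim_harnack _ hv hmono hm x y
  have hnn := fun {x : ℝ} => @neg_prim_nonneg _ hv hmono hm x
  have hdiv := fun {x : ℝ} => @prim_sq_div_le _ hh _ hv2 hm x
  have hint := integrable_prim_sq_div hh hv2 hm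
  have hW := memLp_prim_div hh hv hm
  have hiter := (inverse_iteration hh hg hm hD).1
  set p := prim (fun x => c + prim g x) with hpdef
  set D := ∫ x in Ioo (0 : ℝ) 1, (c + prim g x) ^ 2
  set E := ∫ x in Ioo (0 : ℝ) 1, g x ^ 2 * h x
  set R := ∫ x in Ioo (0 : ℝ) 1, p x ^ 2 / h x with hR
  have hR0 : 0 ≤ R := setIntegral_nonneg measurableSet_Ioo fun x hx =>
    div_nonneg (sq_nonneg _) (hh.pos hx).le
  have hRle : R ≤ 2 / q * D := by
    have : R ≤ ∫ x in Ioo (0 : ℝ) 1, 2 / q * D :=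
      setIntegral_mono_on hint (integrable_const _) measurableSet_Ioo fun x hx => hdiv hx
    rwa [integral_Ioo_const] at this
  -- From D² ≤ E R and the near-optimality E ≤ s D.
  have hRge : D / s ≤ R := by
    have h1 : D * D ≤ D * (s * R) := by
      have := mul_le_mul_of_nonneg_right hE hR0
      nlinarith
    rw [div_le_iff₀ hs0]
    linarith [le_of_mul_le_mul_left h1 hD]
  have hpt : ∀ x ∈ Ioo α β, κ' / (2 * q) ^ 2 * R ≤ (-p x / h x) ^ 2 := by
    intro x hx
    have hxI : x ∈ Ioo (0 : ℝ) 1 := ⟨hα.trans hx.1, hx.2.trans hβ⟩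
    have hθx : θ ≤ x * (1 - x) := by
      have t1 := mul_nonneg (sub_pos.2 hx.1).le (sub_pos.2 hβ).le
      have t2 := mul_nonneg hxI.1.le (sub_pos.2 hx.2).le
      nlinarith
    -- By Harnack, one value p(x) with x in (α, β) controls p everywhere, hence the bulk part of R;
    -- that part is at least D/(2s), so p(x)² cannot be small.
    have hsq : ∀ y ∈ Ioo (0 : ℝ) 1, p y ^ 2 ≤ p x ^ 2 / θ ^ 2 := by
      intro y hy
      rw [le_div_iff₀ (by positivity)]
      have h1 : θ * -p y ≤ -p x :=
        (mul_le_mul_of_nonneg_right hθx (hnn hy)).trans (hharn hxI hy)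
      have h2 := mul_nonneg hθ0.le (hnn hy)
      nlinarith [mul_self_le_mul_self h2 h1]
    have hbulk := integral_le_of_bulk_bound hint hδ0 hδ1
      (B := p x ^ 2 / θ ^ 2 / (q * (δ * (1 - δ)))) (K := 2 / q * D) (by positivity)
      (fun y hy => by
        have hyI : y ∈ Ioo (0 : ℝ) 1 := ⟨hδ0.trans hy.1, by linarith [hy.2]⟩
        refine div_le_div₀ (by positivity) (hsq y hyI) (by positivity) ?_
        refine le_trans (mul_le_mul_of_nonneg_left ?_ hp.le) (hh.lower_bound hyI)
        have t1 := mul_nonneg (sub_pos.2 hy.1).le (sub_pos.2 hy.2).le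
        nlinarith)
      (fun y hy => hdiv hy)
    rw [← hR] at hbulk
    have h3 : D / (2 * s) ≤ p x ^ 2 / θ ^ 2 / (q * (δ * (1 - δ))) := by
      have t := mul_le_mul_of_nonneg_right hδ2 hD.le
      have e1 : 1 / (2 * s) * D = D / s - D / (2 * s) := by field_simp; ring
      have e2 : 2 * δ * (2 / q * D) = 2 * δ * (2 / q) * D := by ring
      rw [e2] at hbulk
      linarith
    rw [div_div, le_div_iff₀ (by positivity)] at h3
    have h4 : κ' * R ≤ p x ^ 2 := by
      refine le_trans (mul_le_mul_of_nonneg_left hRle hκ'0.le) (le_trans (le_of_eq ?_) h3)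
      rw [hκ']
      field_simp
      norm_num
    have hpx := hh.pos hxI
    rw [div_pow, neg_sq, div_mul_eq_mul_div]
    refine div_le_div₀ (sq_nonneg _) h4 (by positivity) ?_
    exact pow_le_pow_left₀ hpx.le (hh.upper_bound hxI) 2
  have hsub : Ioo α β ⊆ Ioo (0 : ℝ) 1 := Ioo_subset_Ioo hα.le hβ.le
  have hI : IntegrableOn (fun x => (-p x / h x) ^ 2) (Ioo α β) :=
    IntegrableOn.mono_set (t := Ioo 0 1) hW.integrable_sq hsub
  have := setIntegral_mono_on (integrableOn_const (C := κ' / (2 * q) ^ 2 * R) (by simp)) hI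
    measurableSet_Ioo hpt
  rw [setIntegral_const, Real.volume_real_Ioo_of_le hαβ.le, smul_eq_mul] at this
  linarith

/-- The energy deficit is bounded below by the energy on an interval. -/
lemma exists_deficit_bound {h : ℝ → ℝ} (hh : IsUnitProfile h) {x₀ : ℝ} (hx₀ : x₀ ∈ Ioo (0 : ℝ) 1)
    (hlt : h x₀ ^ 2 < 2 * h (prim h x₀)) :
    ∃ α β ε : ℝ, 0 < α ∧ α < β ∧ β < 1 ∧ 0 < ε ∧ ∀ g : ℝ → ℝ, MemLp g 2 ν →
      ε * ∫ x in Ioo α β, g x ^ 2 ≤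
        ∫ x in Ioo (0 : ℝ) 1, h x * g (prim h x) ^ 2 * (2 * h (prim h x) - h x ^ 2) := by
  have hcont : ContinuousAt (fun x => 2 * h (prim h x) - h x ^ 2) x₀ := by
    have h1 : ContinuousAt (fun x => h (prim h x)) x₀ :=
      ContinuousAt.comp (g := h) (hh.1.continuousAt (hh.prim_mem_Ioo hx₀))
        (hh.1.hasDerivAt_prim hx₀).continuousAt
    exact (continuousAt_const.mul h1).sub ((hh.1.continuousAt hx₀).pow 2)
  set ε := (2 * h (prim h x₀) - h x₀ ^ 2) / 2 with hε
  have hε0 : 0 < ε := by linarith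
  have hev : ∀ᶠ x in 𝓝 x₀, ε < 2 * h (prim h x) - h x ^ 2 :=
    hcont.eventually (lt_mem_nhds (by linarith))
  obtain ⟨l, u, hlu, hsub⟩ := mem_nhds_iff_exists_Ioo_subset.1
    (Filter.inter_mem hev (Ioo_mem_nhds hx₀.1 hx₀.2))
  have hlu' : l < u := hlu.1.trans hlu.2
  set a := (2 * l + u) / 3 with ha
  set b := (l + 2 * u) / 3 with hb
  have hab : a < b := by linarith
  have hI : ∀ x ∈ Icc a b, ε < 2 * h (prim h x) - h x ^ 2 ∧ x ∈ Ioo (0 : ℝ) 1 := fun x hx =>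
    hsub ⟨by linarith [hx.1], by linarith [hx.2]⟩
  have haI := (hI a ⟨le_rfl, hab.le⟩).2
  have hbI := (hI b ⟨hab.le, le_rfl⟩).2
  -- The deficit is an integral in x, while g lives in the variable y = H(x); the interval must be
  -- moved by H.
  refine ⟨prim h a, prim h b, ε, (hh.prim_mem_Ioo haI).1,
    hh.1.strictMonoOn_prim (Ioo_subset_Icc_self haI) (Ioo_subset_Icc_self hbI) hab,
    (hh.prim_mem_Ioo hbI).2, hε0, fun g hg => ?_⟩
  rw [hh.1.integral_image haI.1.le hab.le hbI.2.le, ← integral_const_mul]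
  have hsub' : Ioo a b ⊆ Ioo (0 : ℝ) 1 := Ioo_subset_Ioo haI.1.le hbI.2.le
  have i0 : Integrable (fun x => h x * g (prim h x) ^ 2) ν :=
    (hh.integrable_comp_iff (fun x => g x ^ 2)).1 hg.integrable_sq
  have i1 : Integrable (fun x => h x * (g (prim h x) ^ 2 * h (prim h x))) ν :=
    (hh.integrable_comp_iff (fun x => g x ^ 2 * h x)).1 (hh.1.integrable_mul hg.integrable_sq)
  have i2 := hh.1.integrable_mul (hh.memLp_comp hg).integrable_sq
  have i3 : Integrable (fun x => h x * g (prim h x) ^ 2 * (2 * h (prim h x) - h x ^ 2)) ν := by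
    refine ((i1.const_mul 2).sub i2).congr (Eventually.of_forall fun x => ?_)
    simp only [Pi.sub_apply]
    ring
  refine le_trans (setIntegral_mono_on ((IntegrableOn.mono_set (t := Ioo 0 1) i0 hsub').const_mul ε)
    (IntegrableOn.mono_set (t := Ioo 0 1) i3 hsub') measurableSet_Ioo fun x hx => ?_)
    (setIntegral_mono_set i3 ?_ hsub'.eventuallyLE)
  · have := mul_le_mul_of_nonneg_left (hI x (Ioo_subset_Icc_self hx)).1.le
      (mul_nonneg (hh.1.pos (hsub' hx)).le (sq_nonneg (g (prim h x))))
    linarith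
  · rw [EventuallyLE, ae_restrict_iff' measurableSet_Ioo]
    exact Eventually.of_forall fun x hx => mul_nonneg
      (mul_nonneg (hh.1.pos hx).le (sq_nonneg _)) (sub_nonneg.2 (hh.sq_le hx))

/-- The deficit is evaluated on the inverse iterate of an arbitrary competitor, where it is at least
ηR; this gives a gap uniform over near-optimal competitors. -/
theorem mu1_lt_two_mul_sigma1 {h : ℝ → ℝ} (hh : IsUnitProfile h) {x₀ : ℝ}
    (hx₀ : x₀ ∈ Ioo (0 : ℝ) 1) (hlt : h x₀ ^ 2 < 2 * h (prim h x₀)) :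
    mu1 h < 2 * sigma1 h := by
  obtain ⟨α, β, ε, hα, hαβ, hβ, hε, hdef⟩ := exists_deficit_bound hh hx₀ hlt
  obtain ⟨κ, hκ, hlow⟩ := exists_energy_lower_bound hh.1 hα hαβ hβ
  have hσ := sigma1_pos hh.1
  set η := min (ε * κ) 1 with hη
  have hη0 : 0 < η := lt_min (mul_pos hε hκ) one_pos
  have hη1 : η ≤ 1 := min_le_right _ _
  have h2η : 0 < 2 - η := by linarith
  -- The term σ₁ + 1 disposes of competitors that are not near-optimal; as a bound for σ₁ itself it
  -- is absurd, so the other term must be the minimum.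
  have key : min (mu1 h / (2 - η)) (sigma1 h + 1) ≤ sigma1 h := by
    refine le_sigma1 fun g₀ c₀ hg₀ hm₀ => ?_
    obtain ⟨c, hm, hle⟩ := exists_monotone_rearrangement hg₀ hm₀
    have hg : MemLp (fun t => |g₀ t|) 2 ν := hg₀.abs
    have hE0 : ∫ x in Ioo (0 : ℝ) 1, |g₀ x| ^ 2 * h x = ∫ x in Ioo (0 : ℝ) 1, g₀ x ^ 2 * h x := by
      simp only [sq_abs]
    have hEn := integral_sq_mul_nonneg hh.1 g₀
    have hD0 := integral_sq_nonneg_Ioo fun x => c₀ + prim g₀ x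
    rcases hD0.eq_or_lt with hz | hpos
    · rw [← hz, mul_zero]; exact hEn
    have hD := hpos.trans_le hle
    have hlow' := hlow (fun t => |g₀ t|) c hg (fun x => abs_nonneg _) hm hD
    obtain ⟨hi1, d, hdm, hi2⟩ := inverse_iteration hh.1 hg hm hD
    have hW := memLp_prim_div hh.1 (continuousOn_const_add_prim hg c) hm
    have hmu := mu1_mul_le_comp hh hW hdm
    rw [integral_comp_energy hh hW] at hmu
    have hdef' := hdef _ hW
    rw [hE0] at hi1 hlow'
    set D₀ := ∫ x in Ioo (0 : ℝ) 1, (c₀ + prim g₀ x) ^ 2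
    set D := ∫ x in Ioo (0 : ℝ) 1, (c + prim (fun t => |g₀ t|) x) ^ 2
    set E := ∫ x in Ioo (0 : ℝ) 1, g₀ x ^ 2 * h x
    set v := prim (fun x => c + prim (fun t => |g₀ t|) x)
    have hRE : ∫ x in Ioo (0 : ℝ) 1, (-v x / h x) ^ 2 * h x =
        ∫ x in Ioo (0 : ℝ) 1, v x ^ 2 / h x := by
      refine setIntegral_congr_fun measurableSet_Ioo fun x hx => ?_
      have := (hh.1.pos hx).ne'
      field_simp
    rw [hRE] at hmu
    set R := ∫ x in Ioo (0 : ℝ) 1, v x ^ 2 / h x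
    set D' := ∫ x in Ioo (0 : ℝ) 1, (d + prim (fun t => -v t / h t) x) ^ 2
    have hmin : min (mu1 h / (2 - η)) (sigma1 h + 1) * D ≤ E := by
      by_cases hbig : E ≤ (sigma1 h + 1) * D
      · have h1 := hlow' hbig
        have hRpos : 0 < R := pos_of_mul_pos_right (lt_of_lt_of_le (by positivity) hi1) hEn
        have h2 : mu1 h * D' ≤ (2 - η) * R := by
          have t1 := mul_le_mul_of_nonneg_left h1 hε.le
          have t2 := mul_le_mul_of_nonneg_right (min_le_left (ε * κ) 1) hRpos.le
          linarith
        have hD'pos : 0 < D' := pos_of_mul_pos_left (lt_of_lt_of_le (by positivity) hi2) hD.le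
        rcases le_or_gt (mu1 h) 0 with hneg | hmupos
        · refine le_trans (mul_le_mul_of_nonneg_right (min_le_left _ _) hD.le) (le_trans ?_ hEn)
          exact mul_nonpos_of_nonpos_of_nonneg (div_nonpos_of_nonpos_of_nonneg hneg h2η.le) hD.le
        refine (mul_le_mul_of_nonneg_right (min_le_left _ _) hD.le).trans ?_
        rw [div_mul_eq_mul_div, div_le_iff₀ h2η]
        -- Chain μ₁D' ≤ (2 - η)R, R² ≤ D'D and D² ≤ ER to reach μ₁D ≤ (2 - η)E.
        have h3 : mu1 h * R ^ 2 ≤ (2 - η) * R * D := by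
          have t1 := mul_le_mul_of_nonneg_left hi2 hmupos.le
          have t2 := mul_le_mul_of_nonneg_right h2 hD.le
          linarith
        have h4 : mu1 h * R ≤ (2 - η) * D := by
          refine le_of_mul_le_mul_right (a := R) ?_ hRpos
          linarith
        refine le_of_mul_le_mul_right (a := D * R) ?_ (mul_pos hD hRpos)
        have t1 := mul_le_mul_of_nonneg_right h4 (sq_nonneg D)
        have t2 := mul_le_mul_of_nonneg_left hi1 (mul_pos h2η hD).le
        nlinarith
      · exact (mul_le_mul_of_nonneg_right (min_le_right _ _) hD.le).trans (not_le.1 hbig).le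
    rcases le_or_gt (min (mu1 h / (2 - η)) (sigma1 h + 1)) 0 with hneg | hp
    · exact (mul_nonpos_of_nonpos_of_nonneg hneg hpos.le).trans hEn
    · exact (mul_le_mul_of_nonneg_left hle hp.le).trans hmin
  rcases min_le_iff.1 key with h1 | h1
  · rw [div_le_iff₀ h2η] at h1
    nlinarith [mul_pos hσ hη0]
  · linarith

/-! ### Rigidity: equality in the pointwise inequality characterises triangles. -/

namespace IsUnitProfile

variable {h : ℝ → ℝ}

lemma prim_sub_lower_bound (hh : IsUnitProfile h) {t x : ℝ} (ht : 0 < t) (htx : t ≤ x)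
    (hx : x < 1) : (x ^ 2 - t ^ 2) * h x ≤ 2 * x * (prim h x - prim h t) := by
  have hx0 : 0 < x := ht.trans_le htx
  have h1 : ∫ s in t..x, s * (h x / x) ≤ ∫ s in t..x, h s := by
    refine intervalIntegral.integral_mono_on_of_le_Ioo htx
      (Continuous.intervalIntegrable (by fun_prop) _ _)
      (intervalIntegrable_sub hh.1.integrable ⟨ht.le, by linarith⟩ ⟨hx0.le, hx.le⟩) ?_
    intro s hs
    have := hh.1.left_le (ht.trans hs.1) hs.2.le hx
    rw [mul_div_assoc', div_le_iff₀ hx0]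
    linarith
  rw [← prim_sub hh.1.integrable ⟨ht.le, by linarith⟩ ⟨hx0.le, hx.le⟩,
    intervalIntegral.integral_mul_const, integral_id] at h1
  have h2 := mul_le_mul_of_nonneg_left h1 (by positivity : 0 ≤ 2 * x)
  refine le_trans (le_of_eq ?_) h2
  field_simp

lemma prim_sub_lower_bound' (hh : IsUnitProfile h) {t x : ℝ} (hx : 0 < x) (hxt : x ≤ t)
    (ht : t < 1) :
    ((1 - x) ^ 2 - (1 - t) ^ 2) * h x ≤ 2 * (1 - x) * (prim h t - prim h x) := by
  have hx1 : 0 < 1 - x := by linarith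
  have h1 : ∫ s in x..t, (1 - s) * (h x / (1 - x)) ≤ ∫ s in x..t, h s := by
    refine intervalIntegral.integral_mono_on_of_le_Ioo hxt
      (Continuous.intervalIntegrable (by fun_prop) _ _)
      (intervalIntegrable_sub hh.1.integrable ⟨hx.le, by linarith⟩ ⟨by linarith, ht.le⟩) ?_
    intro s hs
    have := hh.1.right_le hx hs.1.le (hs.2.trans ht)
    rw [mul_div_assoc', div_le_iff₀ hx1]
    linarith
  rw [← prim_sub hh.1.integrable ⟨hx.le, by linarith⟩ ⟨by linarith, ht.le⟩,
    intervalIntegral.integral_mul_const, intervalIntegral.integral_sub (by simp) (by simp),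
    integral_id, intervalIntegral.integral_const] at h1
  have h2 := mul_le_mul_of_nonneg_left h1 (by positivity : 0 ≤ 2 * (1 - x))
  refine le_trans (le_of_eq ?_) h2
  simp only [smul_eq_mul]
  field_simp
  ring

/-- If the area under the graph on (0,x) is that of the triangle, subtracting the trapezoid over
(t,x) gives 2x H(t) ≤ t² h(x); with t h(t) ≤ 2H(t) this puts h(t) on the chord. -/
lemma linear_left (hh : IsUnitProfile h) {t x : ℝ} (ht : 0 < t) (htx : t ≤ x) (hx : x < 1)
    (he : x * h x = 2 * prim h x) : x * h t = t * h x := by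
  have h1 := hh.prim_sub_lower_bound ht htx hx
  have h2 := hh.mul_le_two_mul_prim (x := t) ⟨ht, by linarith⟩
  have h3 := hh.1.left_le ht htx hx
  refine le_antisymm (le_of_mul_le_mul_left (a := t) ?_ ht) h3
  have h4 := mul_le_mul_of_nonneg_left h2 (ht.trans_le htx).le
  have h5 : x * (x * h x) = x * (2 * prim h x) := by rw [he]
  linarith

lemma linear_right (hh : IsUnitProfile h) {t x : ℝ} (hx : 0 < x) (hxt : x ≤ t) (ht : t < 1)
    (he : (1 - x) * h x = 2 * (1 - prim h x)) : (1 - x) * h t = (1 - t) * h x := by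
  have h1 := hh.prim_sub_lower_bound' hx hxt ht
  have h2 := hh.one_sub_mul_le (x := t) ⟨by linarith, ht⟩
  have h3 := hh.1.right_le hx hxt ht
  refine le_antisymm (le_of_mul_le_mul_left (a := 1 - t) ?_ (sub_pos.2 ht)) h3
  have h4 := mul_le_mul_of_nonneg_left h2 (a := 1 - x) (by linarith)
  have h5 : (1 - x) * ((1 - x) * h x) = (1 - x) * (2 * (1 - prim h x)) := by rw [he]
  linarith

/-- Equality at the ends of x h² ≤ 2H h ≤ 2x h(H) forces equality in the first step. -/
lemma eq_left_of_sq_eq (hh : IsUnitProfile h) {x : ℝ} (hx : x ∈ Ioo (0 : ℝ) 1)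
    (he : h x ^ 2 = 2 * h (prim h x)) (hle : prim h x ≤ x) : x * h x = 2 * prim h x := by
  have h0 := hh.1.pos hx
  have h1 := hh.1.left_le (hh.prim_mem_Ioo hx).1 hle hx.2
  refine le_antisymm (hh.mul_le_two_mul_prim hx) (le_of_mul_le_mul_right (a := h x) ?_ h0)
  have h2 : x * h x ^ 2 = x * (2 * h (prim h x)) := by rw [he]
  linarith

lemma eq_right_of_sq_eq (hh : IsUnitProfile h) {x : ℝ} (hx : x ∈ Ioo (0 : ℝ) 1)
    (he : h x ^ 2 = 2 * h (prim h x)) (hle : x ≤ prim h x) :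
    (1 - x) * h x = 2 * (1 - prim h x) := by
  have h0 := hh.1.pos hx
  have h1 := hh.1.right_le hx.1 hle (hh.prim_mem_Ioo hx).2
  refine le_antisymm (hh.one_sub_mul_le hx) (le_of_mul_le_mul_right (a := h x) ?_ h0)
  have h2 : (1 - x) * h x ^ 2 = (1 - x) * (2 * h (prim h x)) := by rw [he]
  linarith

/-- Rigidity in the pointwise comparison: equality everywhere forces a triangular profile. -/
lemma exists_triangle_of_sq_eq (hh : IsUnitProfile h)
    (he : ∀ x ∈ Ioo (0 : ℝ) 1, h x ^ 2 = 2 * h (prim h x)) :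
    ∃ x₀ ∈ Icc (0 : ℝ) 1, EqOn h (triangle x₀) (Ioo 0 1) := by
  -- An interior fixed point of H is the vertex: both one-sided equalities hold there, and their sum
  -- gives h(a) = 2. Without one, H - id keeps its sign, so h is linear on all of (0,1) and the unit
  -- mass fixes its slope.
  by_cases hfix : ∃ a ∈ Ioo (0 : ℝ) 1, prim h a = a
  · obtain ⟨a, ha, hfa⟩ := hfix
    have hl := hh.eq_left_of_sq_eq ha (he a ha) hfa.le
    have hr := hh.eq_right_of_sq_eq ha (he a ha) hfa.ge
    have h2 : h a = 2 := by linarith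
    have ha1 : 0 < 1 - a := sub_pos.2 ha.2
    refine ⟨a, Ioo_subset_Icc_self ha, fun x hx => ?_⟩
    rw [triangle, if_neg ha.1.ne', if_neg ha.2.ne]
    split_ifs with hxa
    · have := hh.linear_left hx.1 hxa.le ha.2 hl
      rw [eq_div_iff ha.1.ne']
      rw [h2] at this; linarith
    · have := hh.linear_right ha.1 (not_lt.1 hxa) hx.2 hr
      rw [eq_div_iff ha1.ne']
      rw [h2] at this; linarith
  have hcont : ContinuousOn (fun x => prim h x - x) (Ioo 0 1) :=
    ((continuousOn_prim hh.1.integrable).mono Ioo_subset_Icc_self).sub continuousOn_id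
  have hhalf : (1 / 2 : ℝ) ∈ Ioo (0 : ℝ) 1 := by norm_num
  rcases le_total (prim h (1 / 2)) (1 / 2) with hle | hle
  · have hall : ∀ x ∈ Ioo (0 : ℝ) 1, prim h x ≤ x := by
      intro x hx
      by_contra hlt
      obtain ⟨a, ha, ha0⟩ := isPreconnected_Ioo.intermediate_value hhalf hx hcont
        (show (0 : ℝ) ∈ Icc _ _ from ⟨by linarith, by linarith⟩)
      exact hfix ⟨a, ha, by simp only at ha0; linarith⟩
    have hlin : ∀ t ∈ Ioo (0 : ℝ) 1, ∀ x ∈ Ioo (0 : ℝ) 1, t ≤ x → x * h t = t * h x :=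
      fun t ht x hx htx => hh.linear_left ht.1 htx hx.2
        (hh.eq_left_of_sq_eq hx (he x hx) (hall x hx))
    have hk : ∀ x ∈ Ioo (0 : ℝ) 1, h x = x * (2 * h (1 / 2)) := by
      intro x hx
      rcases le_total x (1 / 2) with hc | hc
      · linarith [hlin x hx _ hhalf hc]
      · linarith [hlin _ hhalf x hx hc]
    have hint := hh.2
    rw [setIntegral_congr_fun measurableSet_Ioo hk, ← intervalIntegral_eq_Ioo,
      intervalIntegral.integral_mul_const, integral_id] at hint
    refine ⟨1, by simp, fun x hx => ?_⟩
    rw [triangle, if_neg one_ne_zero, if_pos rfl, hk x hx]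
    have : 2 * h (1 / 2) = 2 := by linarith
    rw [this, mul_comm]
  · have hall : ∀ x ∈ Ioo (0 : ℝ) 1, x ≤ prim h x := by
      intro x hx
      by_contra hlt
      obtain ⟨a, ha, ha0⟩ := isPreconnected_Ioo.intermediate_value hx hhalf hcont
        (show (0 : ℝ) ∈ Icc _ _ from ⟨by linarith, by linarith⟩)
      exact hfix ⟨a, ha, by simp only at ha0; linarith⟩
    have hlin : ∀ x ∈ Ioo (0 : ℝ) 1, ∀ t ∈ Ioo (0 : ℝ) 1, x ≤ t → (1 - x) * h t = (1 - t) * h x :=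
      fun x hx t ht hxt => hh.linear_right hx.1 hxt ht.2
        (hh.eq_right_of_sq_eq hx (he x hx) (hall x hx))
    have hk : ∀ x ∈ Ioo (0 : ℝ) 1, h x = (1 - x) * (2 * h (1 / 2)) := by
      intro x hx
      rcases le_total x (1 / 2) with hc | hc
      · linarith [hlin x hx _ hhalf hc]
      · linarith [hlin _ hhalf x hx hc]
    have hint := hh.2
    rw [setIntegral_congr_fun measurableSet_Ioo hk, ← intervalIntegral_eq_Ioo,
      intervalIntegral.integral_mul_const, intervalIntegral.integral_sub (by simp) (by simp),
      integral_id, intervalIntegral.integral_const, smul_eq_mul] at hint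
    refine ⟨0, by simp, fun x hx => ?_⟩
    rw [triangle, if_pos rfl, hk x hx]
    have : 2 * h (1 / 2) = 2 := by linarith
    rw [this, mul_comm]

lemma prim_of_linear_left {k x : ℝ} (hx : 0 ≤ x) (hk : ∀ t ∈ Ioo 0 x, h t = k * t) :
    prim h x = k * x ^ 2 / 2 := by
  rw [prim, intervalIntegral.integral_of_le hx, integral_Ioc_eq_integral_Ioo,
    setIntegral_congr_fun measurableSet_Ioo hk, ← integral_Ioc_eq_integral_Ioo,
    ← intervalIntegral.integral_of_le hx, intervalIntegral.integral_const_mul, integral_id]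
  ring

lemma prim_of_linear_right (hh : IsUnitProfile h) {k x : ℝ} (hx : x ∈ Icc (0 : ℝ) 1)
    (hk : ∀ t ∈ Ioo x 1, h t = k * (1 - t)) : prim h x = 1 - k * (1 - x) ^ 2 / 2 := by
  have := prim_sub hh.1.integrable hx (b := 1) (by simp)
  rw [hh.prim_one, intervalIntegral.integral_of_le hx.2, integral_Ioc_eq_integral_Ioo,
    setIntegral_congr_fun measurableSet_Ioo hk, ← integral_Ioc_eq_integral_Ioo,
    ← intervalIntegral.integral_of_le hx.2, intervalIntegral.integral_const_mul,
    intervalIntegral.integral_sub (by simp) (by simp), integral_id,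
    intervalIntegral.integral_const, smul_eq_mul] at this
  linarith

/-- On each side of the vertex H is an explicit quadratic that maps this side to itself, so h ∘ H is
evaluated on the same linear branch as h. -/
lemma sq_eq_of_triangle (hh : IsUnitProfile h) {x₀ : ℝ} (hx₀ : x₀ ∈ Icc (0 : ℝ) 1)
    (he : EqOn h (triangle x₀) (Ioo 0 1)) {x : ℝ} (hx : x ∈ Ioo (0 : ℝ) 1) :
    h x ^ 2 = 2 * h (prim h x) := by
  have hp := hh.prim_mem_Ioo hx
  have hxc := Ioo_subset_Icc_self hx
  by_cases h0 : x₀ = 0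
  · have hk : ∀ t ∈ Ioo (0 : ℝ) 1, h t = 2 * (1 - t) := fun t ht => by
      rw [he ht, triangle, if_pos h0]
    have := hh.prim_of_linear_right hxc fun t ht => hk t ⟨hx.1.trans ht.1, ht.2⟩
    rw [hk _ hp, hk _ hx, this]; ring
  by_cases h1 : x₀ = 1
  · have hk : ∀ t ∈ Ioo (0 : ℝ) 1, h t = 2 * t := fun t ht => by
      rw [he ht, triangle, if_neg h0, if_pos h1]
    have := prim_of_linear_left hx.1.le fun t ht => hk t ⟨ht.1, ht.2.trans hx.2⟩
    rw [hk _ hp, hk _ hx, this]; ring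
  have hpos : 0 < x₀ := lt_of_le_of_ne hx₀.1 (Ne.symm h0)
  have hpos' : 0 < 1 - x₀ := sub_pos.2 (lt_of_le_of_ne hx₀.2 h1)
  have hkl : ∀ t ∈ Ioo (0 : ℝ) 1, t < x₀ → h t = 2 / x₀ * t := fun t ht htx => by
    rw [he ht, triangle, if_neg h0, if_neg h1, if_pos htx]; ring
  have hkr : ∀ t ∈ Ioo (0 : ℝ) 1, x₀ ≤ t → h t = 2 / (1 - x₀) * (1 - t) := fun t ht htx => by
    rw [he ht, triangle, if_neg h0, if_neg h1, if_neg (not_lt.2 htx)]; ring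
  rcases lt_or_ge x x₀ with hlt | hge
  · have hpx := prim_of_linear_left hx.1.le fun t ht =>
      hkl t ⟨ht.1, ht.2.trans hx.2⟩ (ht.2.trans hlt)
    have hpe : prim h x = x * x / x₀ := by rw [hpx]; field_simp
    have hpl : prim h x < x₀ := by
      rw [hpe, div_lt_iff₀ hpos]
      exact mul_lt_mul'' hlt hlt hx.1.le hx.1.le
    rw [hkl _ hp hpl, hkl _ hx hlt, hpe]
    field_simp
  · have hpx := hh.prim_of_linear_right hxc fun t ht =>
      hkr t ⟨hx.1.trans ht.1, ht.2⟩ (hge.trans ht.1.le)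
    have hpe : 1 - prim h x = (1 - x) * (1 - x) / (1 - x₀) := by rw [hpx]; field_simp; ring
    have hpl : x₀ ≤ prim h x := by
      have : (1 - x) * (1 - x) / (1 - x₀) ≤ 1 - x₀ := by
        rw [div_le_iff₀ hpos']
        exact mul_self_le_mul_self (sub_pos.2 hx.2).le (by linarith)
      linarith
    rw [hkr _ hp hpl, hkr _ hx hge, hpe]
    field_simp

end IsUnitProfile

/-! ### Reverse transplantation: triangles attain the bound. -/

lemma prim_congr {f g : ℝ → ℝ} (he : EqOn f g (Ioo 0 1)) {x : ℝ} (hx : x ∈ Icc (0 : ℝ) 1) :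
    prim f x = prim g x := by
  rw [prim, prim, intervalIntegral.integral_of_le hx.1, intervalIntegral.integral_of_le hx.1,
    integral_Ioc_eq_integral_Ioo, integral_Ioc_eq_integral_Ioo]
  exact setIntegral_congr_fun measurableSet_Ioo (he.mono (Ioo_subset_Ioo le_rfl hx.2))

lemma integrable_sq_div_of_support {h : ℝ → ℝ} (hh : IsProfile h) {g : ℝ → ℝ} (hg : MemLp g 2 ν)
    {δ : ℝ} (h0 : 0 < δ) (hs : ∀ x, x ∉ Ioo δ (1 - δ) → g x = 0) :
    Integrable (fun x => g x ^ 2 / h x) ν := by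
  by_cases hδ1 : δ < 1
  swap
  · have : ∀ x, g x = 0 := fun x => hs x fun hx => by linarith [hx.1, hx.2]
    simp [this]
  have hp := hh.half_pos
  have hc : 0 < h (1 / 2) * (δ * δ) := by positivity
  have hmeas : AEStronglyMeasurable (fun x => g x ^ 2 / h x) ν :=
    ((hg.1.aemeasurable.pow_const 2).div hh.aestronglyMeasurable.aemeasurable).aestronglyMeasurable
  refine (hg.integrable_sq.const_mul (h (1 / 2) * (δ * δ))⁻¹).mono' hmeas ?_
  rw [ae_restrict_iff' measurableSet_Ioo]
  refine Eventually.of_forall fun x hx => ?_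
  have hpx := hh.pos hx
  rw [Real.norm_of_nonneg (div_nonneg (sq_nonneg _) hpx.le)]
  by_cases hx' : x ∈ Ioo δ (1 - δ)
  · rw [div_eq_inv_mul]
    refine mul_le_mul_of_nonneg_right (inv_anti₀ hc ?_) (sq_nonneg _)
    refine le_trans (mul_le_mul_of_nonneg_left ?_ hp.le) (hh.lower_bound hx)
    exact mul_le_mul hx'.1.le (by linarith [hx'.2]) h0.le hx.1.le
  · rw [hs x hx']; simp

/-- If `h ^ 2 = 2 * h ∘ prim h`, then a Neumann test function whose derivative
vanishes near the boundary can be transplanted to a Steklov test function. -/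
lemma sigma1_mul_le_of_sq_eq {h : ℝ → ℝ} (hh : IsUnitProfile h)
    (he : ∀ x ∈ Ioo (0 : ℝ) 1, h x ^ 2 = 2 * h (prim h x)) {g : ℝ → ℝ} (hg : MemLp g 2 ν)
    {δ : ℝ} (h0 : 0 < δ) (hs : ∀ x, x ∉ Ioo δ (1 - δ) → g x = 0) (c : ℝ) :
    2 * sigma1 h * ((∫ x in Ioo (0 : ℝ) 1, (c + prim g x) ^ 2 * h x) -
      (∫ x in Ioo (0 : ℝ) 1, (c + prim g x) * h x) ^ 2) ≤
      ∫ x in Ioo (0 : ℝ) 1, g x ^ 2 * h x := by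
  -- G is the derivative of `prim g` ∘ H⁻¹. Its square integral is ∫ g²/h, finite here because g
  -- vanishes near the endpoints.
  set G : ℝ → ℝ := fun y => g (Function.invFunOn (prim h) (Ioo 0 1) y) /
    h (Function.invFunOn (prim h) (Ioo 0 1) y) with hG
  have hGc : ∀ x ∈ Ioo (0 : ℝ) 1, G (prim h x) = g x / h x := by
    intro x hx
    have : Function.invFunOn (prim h) (Ioo 0 1) (prim h x) = x :=
      (hh.1.strictMonoOn_prim.injOn.mono Ioo_subset_Icc_self).leftInvOn_invFunOn hx
    simp only [hG, this]
  have hGh : EqOn (fun t => h t * G (prim h t)) g (Ioo 0 1) := fun t ht => by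
    have := (hh.1.pos ht).ne'
    simp only [hGc t ht]
    field_simp
  have hG2 : EqOn (fun t => h t * G (prim h t) ^ 2) (fun t => g t ^ 2 / h t) (Ioo 0 1) :=
    fun t ht => by
      have := (hh.1.pos ht).ne'
      simp only [hGc t ht]
      field_simp
  have hGi : Integrable G ν :=
    (hh.integrable_comp_iff G).2 ((integrableOn_congr_fun hGh measurableSet_Ioo).2 hg.integrable_Ioo)
  have hGm : MemLp G 2 ν := by
    rw [memLp_two_iff_integrable_sq hGi.1]
    refine (hh.integrable_comp_iff fun y => G y ^ 2).2
      ((integrableOn_congr_fun hG2 measurableSet_Ioo).2 ?_)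
    exact integrable_sq_div_of_support hh.1 hg h0 hs
  have hpr : ∀ x ∈ Ioo (0 : ℝ) 1, prim G (prim h x) = prim g x := fun x hx => by
    rw [← hh.prim_comp G (Ioo_subset_Icc_self hx), prim_congr hGh (Ioo_subset_Icc_self hx)]
  have key := sigma1_mul_le hh.1 hGm c
  have e1 : ∫ x in Ioo (0 : ℝ) 1, (c + prim G x) ^ 2 =
      ∫ x in Ioo (0 : ℝ) 1, (c + prim g x) ^ 2 * h x := by
    rw [hh.integral_comp fun x => (c + prim G x) ^ 2]
    refine setIntegral_congr_fun measurableSet_Ioo fun x hx => ?_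
    simp only [hpr x hx, mul_comm]
  have e2 : ∫ x in Ioo (0 : ℝ) 1, (c + prim G x) = ∫ x in Ioo (0 : ℝ) 1, (c + prim g x) * h x := by
    rw [hh.integral_comp fun x => (c + prim G x)]
    refine setIntegral_congr_fun measurableSet_Ioo fun x hx => ?_
    simp only [hpr x hx, mul_comm]
  have e3 : ∫ x in Ioo (0 : ℝ) 1, G x ^ 2 * h x =
      1 / 2 * ∫ x in Ioo (0 : ℝ) 1, g x ^ 2 * h x := by
    rw [hh.integral_comp fun x => G x ^ 2 * h x, ← integral_const_mul]
    refine setIntegral_congr_fun measurableSet_Ioo fun x hx => ?_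
    have h1 := (hh.1.pos hx).ne'
    have h2 : h (prim h x) = h x ^ 2 / 2 := by linarith [he x hx]
    simp only [hGc x hx, h2]
    field_simp
  rw [e1, e2, e3] at key
  linarith

lemma tendsto_integral_mul_of_bounded {h : ℝ → ℝ} (hh : IsProfile h) {v : ℕ → ℝ → ℝ} {w : ℝ → ℝ}
    (hv : ∀ n, AEStronglyMeasurable (v n) ν) {M : ℝ}
    (hM : ∀ n, ∀ x ∈ Ioo (0 : ℝ) 1, |v n x| ≤ M)
    (hlim : ∀ x ∈ Ioo (0 : ℝ) 1, Tendsto (fun n => v n x) atTop (𝓝 (w x))) :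
    Tendsto (fun n => ∫ x in Ioo (0 : ℝ) 1, v n x * h x) atTop
      (𝓝 (∫ x in Ioo (0 : ℝ) 1, w x * h x)) := by
  refine tendsto_integral_of_dominated_convergence (fun x => M * h x)
    (fun n => (hv n).mul hh.aestronglyMeasurable) (hh.integrable.const_mul M) (fun n => ?_) ?_
  · rw [ae_restrict_iff' measurableSet_Ioo]
    refine Eventually.of_forall fun x hx => ?_
    rw [norm_mul, Real.norm_of_nonneg (hh.pos hx).le]
    exact mul_le_mul_of_nonneg_right (hM n x hx) (hh.pos hx).le
  · rw [ae_restrict_iff' measurableSet_Ioo]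
    exact Eventually.of_forall fun x hx => (hlim x hx).mul_const _

/-- A general derivative is cut off to (δ, 1 - δ). This does not increase the energy, and the
weighted variance converges by dominated convergence; the variance form is needed since cut-offs
lose the mean-zero constraint. -/
theorem two_mul_sigma1_le_mu1 {h : ℝ → ℝ} (hh : IsUnitProfile h)
    (he : ∀ x ∈ Ioo (0 : ℝ) 1, h x ^ 2 = 2 * h (prim h x)) : 2 * sigma1 h ≤ mu1 h := by
  refine le_mu1 hh fun g c hg hm => ?_
  set δ : ℕ → ℝ := fun n => 1 / ((n : ℝ) + 1) with hδ
  have hδ0 : ∀ n, 0 < δ n := fun n => by positivity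
  have hδlim : Tendsto δ atTop (𝓝 0) := tendsto_one_div_add_atTop_nhds_zero_nat
  set γ : ℕ → ℝ → ℝ := fun n => (Ioo (δ n) (1 - δ n)).indicator g with hγ
  have hγL : ∀ n, MemLp (γ n) 2 ν := fun n => hg.indicator measurableSet_Ioo
  have hγle : ∀ n x, |γ n x| ≤ |g x| := fun n x => by
    simp only [hγ, indicator]
    split_ifs
    · exact le_rfl
    · simp
  have hγlim : ∀ x ∈ Ioo (0 : ℝ) 1, Tendsto (fun n => γ n x) atTop (𝓝 (g x)) := by
    intro x hx
    refine tendsto_const_nhds.congr' ?_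
    filter_upwards [hδlim.eventually (gt_mem_nhds hx.1),
      hδlim.eventually (gt_mem_nhds (sub_pos.2 hx.2))] with n h1 h2
    have hmem : x ∈ Ioo (δ n) (1 - δ n) := ⟨h1, by linarith⟩
    exact (indicator_of_mem hmem g).symm
  have hpm : ∀ x ∈ Ioo (0 : ℝ) 1, Tendsto (fun n => c + prim (γ n) x) atTop (𝓝 (c + prim g x)) := by
    intro x hx
    refine Tendsto.const_add c ?_
    have hsub : Ioc 0 x ⊆ Ioo (0 : ℝ) 1 := fun t ht => ⟨ht.1, ht.2.trans_lt hx.2⟩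
    refine intervalIntegral.tendsto_integral_filter_of_dominated_convergence (fun t => |g t|)
      (Eventually.of_forall fun n => ?_) (Eventually.of_forall fun n =>
        Eventually.of_forall fun t _ => hγle n t)
      (intervalIntegrable_sub hg.integrable_Ioo.abs (by simp) (Ioo_subset_Icc_self hx))
      (Eventually.of_forall fun t ht => ?_)
    · rw [uIoc_of_le hx.1.le]
      exact (hγL n).1.mono_measure (Measure.restrict_mono hsub le_rfl)
    · rw [uIoc_of_le hx.1.le] at ht
      exact hγlim t (hsub ht)
  have hbd : ∀ n, ∀ x ∈ Ioo (0 : ℝ) 1,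
      |c + prim (γ n) x| ≤ |c| + prim (fun t => |g t|) 1 := by
    intro n x hx
    have hxc := Ioo_subset_Icc_self hx
    refine (abs_add_le _ _).trans (add_le_add_right ?_ _)
    have h1 := abs_prim_sub_le (hγL n).integrable_Ioo (x := 0) (by simp) hxc
    rw [prim_zero, prim_zero, sub_zero, sub_zero] at h1
    have h2 : 0 ≤ prim (fun t => |γ n t|) x :=
      intervalIntegral.integral_nonneg hx.1.le fun t _ => abs_nonneg _
    rw [abs_of_nonneg h2] at h1
    refine h1.trans (le_trans ?_ (prim_mono_of_nonneg hg.integrable_Ioo.abs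
      (fun t => abs_nonneg (g t)) hxc (by simp) hx.2.le))
    exact intervalIntegral.integral_mono_on hx.1.le
      (intervalIntegrable_sub (hγL n).integrable_Ioo.abs (by simp) hxc)
      (intervalIntegrable_sub hg.integrable_Ioo.abs (by simp) hxc) fun t _ => hγle n t
  have hmeas : ∀ n, AEStronglyMeasurable (fun x => c + prim (γ n) x) ν := fun n =>
    (memLp_prim (hγL n).integrable_Ioo c 2).1
  have l1 := tendsto_integral_mul_of_bounded hh.1 hmeas hbd hpm
  have l2 := tendsto_integral_mul_of_bounded hh.1 (v := fun n x => (c + prim (γ n) x) ^ 2)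
    (w := fun x => (c + prim g x) ^ 2) (M := (|c| + prim (fun t => |g t|) 1) ^ 2)
    (fun n => (hmeas n).pow 2)
    (fun n x hx => by
      rw [abs_pow]
      exact pow_le_pow_left₀ (abs_nonneg _) (hbd n x hx) 2)
    (fun x hx => (hpm x hx).pow 2)
  have l3 := (l2.sub (l1.pow 2)).const_mul (2 * sigma1 h)
  rw [hm] at l3
  have := le_of_tendsto' (b := ∫ x in Ioo (0 : ℝ) 1, g x ^ 2 * h x) l3 fun n => by
    refine (sigma1_mul_le_of_sq_eq hh he (hγL n) (hδ0 n)
      (fun x hx => indicator_of_notMem hx g) c).trans ?_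
    refine setIntegral_mono_on (hh.1.integrable_mul (hγL n).integrable_sq)
      (hh.1.integrable_mul hg.integrable_sq) measurableSet_Ioo fun x hx => ?_
    exact mul_le_mul_of_nonneg_right (sq_le_sq.2 (hγle n x)) (hh.1.pos hx).le
  simpa using this

/-! ### The lower bound for symmetric profiles. -/

lemma integral_Ioo_reflect (f : ℝ → ℝ) :
    ∫ x in Ioo (0 : ℝ) 1, f (1 - x) = ∫ x in Ioo (0 : ℝ) 1, f x := by
  rw [← intervalIntegral_eq_Ioo, ← intervalIntegral_eq_Ioo,
    intervalIntegral.integral_comp_sub_left]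
  norm_num

lemma memLp_reflect {g : ℝ → ℝ} (hg : MemLp g 2 ν) : MemLp (fun x => g (1 - x)) 2 ν := by
  have hmp : MeasurePreserving (fun x : ℝ => 1 - x) ν ν := by
    have := (Measure.measurePreserving_sub_left volume (1 : ℝ)).restrict_preimage
      (measurableSet_Ioo (a := (0 : ℝ)) (b := 1))
    have e : (fun x : ℝ => 1 - x) ⁻¹' Ioo 0 1 = Ioo 0 1 := by
      rw [preimage_const_sub_Ioo]; norm_num
    rwa [e] at this
  exact hg.comp_measurePreserving hmp

/-- Chebyshev's inequality for a symmetric concave weight and a square increasing with the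
distance to the centre. -/
lemma integral_sq_mul_le_of_symmetric {h : ℝ → ℝ} (hh : IsUnitProfile h)
    (hsym : ∀ x ∈ Ioo (0 : ℝ) 1, h x = h (1 - x)) {w : ℝ → ℝ} (hw : ContinuousOn w (Icc 0 1))
    (hmono : ∀ x ∈ Ioo (0 : ℝ) 1, ∀ y ∈ Ioo (0 : ℝ) 1, |x - 1 / 2| ≤ |y - 1 / 2| → w x ≤ w y) :
    ∫ x in Ioo (0 : ℝ) 1, w x * h x ≤ ∫ x in Ioo (0 : ℝ) 1, w x := by
  have hdec : ∀ x ∈ Ioo (0 : ℝ) 1, ∀ y ∈ Ioo (0 : ℝ) 1, |x - 1 / 2| ≤ |y - 1 / 2| → h y ≤ h x := by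
    intro x hx y hy hxy
    -- The point x lies between y and 1 - y, where h takes equal values; concavity gives h(x) ≥
    -- h(y).
    have hy' : 1 - y ∈ Ioo (0 : ℝ) 1 := ⟨by linarith [hy.2], by linarith [hy.1]⟩
    have hseg : x ∈ segment ℝ y (1 - y) := by
      rw [segment_eq_uIcc]
      rcases abs_cases (x - 1 / 2) with ⟨a1, a2⟩ | ⟨a1, a2⟩ <;>
      rcases abs_cases (y - 1 / 2) with ⟨b1, b2⟩ | ⟨b1, b2⟩
      · rw [uIcc_of_ge (by linarith)]; constructor <;> linarith
      · rw [uIcc_of_le (by linarith)]; constructor <;> linarith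
      · rw [uIcc_of_ge (by linarith)]; constructor <;> linarith
      · rw [uIcc_of_le (by linarith)]; constructor <;> linarith
    have := hh.1.2.2.1.min_le_of_mem_segment hy hy' hseg
    rwa [← hsym y hy, min_self] at this
  obtain ⟨p, hp, hp1⟩ : ∃ p ∈ Ioo (0 : ℝ) 1, h p = 1 := by
    have hhalf : (1 / 2 : ℝ) ∈ Ioo (0 : ℝ) 1 := by norm_num
    have hge : 1 ≤ h (1 / 2) := by
      have : ∫ x in Ioo (0 : ℝ) 1, h x ≤ ∫ x in Ioo (0 : ℝ) 1, h (1 / 2) :=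
        setIntegral_mono_on hh.1.integrable (integrable_const _) measurableSet_Ioo
          fun x hx => hdec _ hhalf x hx (by simp)
      rwa [hh.2, integral_Ioo_const] at this
    by_cases hex : ∃ x ∈ Ioo (0 : ℝ) 1, h x ≤ 1
    · obtain ⟨x, hx, hx1⟩ := hex
      exact isPreconnected_Ioo.intermediate_value hx hhalf hh.1.continuousOn ⟨hx1, hge⟩
    · push Not at hex
      exfalso
      have hi : Integrable (fun x => h x - 1) ν := hh.1.integrable.sub (integrable_const 1)
      have hpos : 0 < ∫ x in Ioo (0 : ℝ) 1, 1 ^ 2 * (h x - 1) :=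
        integral_sq_mul_pos (h := fun x => h x - 1) (v := fun _ => 1)
          (fun x hx => sub_pos.2 (hex x hx))
          (by simpa using hi) (fun h0 => by
            have := integral_congr_ae h0
            simp at this)
      simp only [one_pow, one_mul] at hpos
      rw [integral_sub hh.1.integrable (integrable_const _), hh.2, integral_Ioo_const] at hpos
      linarith
  have i0 := integrable_Ioo_of_continuousOn hw
  have i1 := hh.1.integrable_mul i0
  have i2 : Integrable (fun x => w p * (h x - 1)) ν :=
    (hh.1.integrable.sub (integrable_const _)).const_mul _
  -- Since h(p) = 1, the factors w - w(p) and h - 1 have opposite signs on both sides of the level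
  -- |p - 1/2|; and h - 1 has mean zero.
  have hmain : ∫ x in Ioo (0 : ℝ) 1, (w x * h x - w x) ≤
      ∫ x in Ioo (0 : ℝ) 1, w p * (h x - 1) := by
    refine setIntegral_mono_on (i1.sub i0) i2 measurableSet_Ioo fun x hx => ?_
    rcases le_total |x - 1 / 2| |p - 1 / 2| with hc | hc
    · have a := hdec x hx p hp hc
      have b := hmono x hx p hp hc
      rw [hp1] at a
      nlinarith
    · have a := hdec p hp x hx hc
      have b := hmono p hp x hx hc
      rw [hp1] at a
      nlinarith
  rw [integral_sub i1 i0, integral_const_mul, integral_sub hh.1.integrable (integrable_const _),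
    hh.2, integral_Ioo_const] at hmain
  linarith

/-- With u = c + `prim g` and f = u - u(1/2), the chain is 2σ₁∫u²h ≤ 2σ₁∫f²h ≤ σ₁∫V²h ≤ σ₁∫V² ≤ ∫G²h
= 2∫g²h. Complex numbers serve only as the Euclidean plane, to apply the norm inequality for vector
integrals. -/
theorem sigma1_le_mu1_of_symmetric {h : ℝ → ℝ} (hh : IsUnitProfile h)
    (hsym : ∀ x ∈ Ioo (0 : ℝ) 1, h x = h (1 - x)) : sigma1 h ≤ mu1 h := by
  refine le_mu1 hh fun g c hg hm => ?_
  have hgr := memLp_reflect hg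
  have hhalf : (1 / 2 : ℝ) ∈ Icc (0 : ℝ) 1 := by norm_num
  -- the even majorant of the derivative
  set z : ℝ → ℂ := fun t => ⟨g t, g (1 - t)⟩ with hz
  set G : ℝ → ℝ := fun t => ‖z t‖ with hGdef
  have hGsq : ∀ t, G t ^ 2 = g t ^ 2 + g (1 - t) ^ 2 := fun t => by
    rw [hGdef, hz]
    simp only
    rw [Complex.sq_norm, Complex.normSq_mk]; ring
  have hzi : Integrable z ν := by
    have h1 : Integrable (fun t => (g t : ℂ)) ν := hg.integrable_Ioo.ofReal
    have h2 : Integrable (fun t => (g (1 - t) : ℂ)) ν := hgr.integrable_Ioo.ofReal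
    refine (h1.add (h2.mul_const Complex.I)).congr (Eventually.of_forall fun t => ?_)
    simp [hz, Complex.ext_iff]
  have hGi : Integrable G ν := hzi.norm
  have hGL : MemLp G 2 ν := by
    rw [memLp_two_iff_integrable_sq hGi.1]
    simp only [hGsq]
    exact hg.integrable_sq.add hgr.integrable_sq
  have hGnn : ∀ t, 0 ≤ G t := fun t => norm_nonneg _
  have hGev : ∀ t, G (1 - t) = G t := fun t => by
    rw [← abs_of_nonneg (hGnn (1 - t)), ← abs_of_nonneg (hGnn t), ← sq_eq_sq_iff_abs_eq_abs, hGsq,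
      hGsq, sub_sub_cancel, add_comm]
  -- Vanishing at the centre makes V odd, hence of mean zero and admissible for σ₁, and makes V²
  -- increase with the distance to 1/2.
  set V : ℝ → ℝ := fun x => -prim G (1 / 2) + prim G x with hV
  have hVc := continuousOn_const_add_prim hGL (-prim G (1 / 2))
  have hVmono : MonotoneOn V (Icc 0 1) := fun x hx y hy hxy =>
    add_le_add_right (prim_mono_of_nonneg hGi hGnn hx hy hxy) _
  have hVint : ∀ x ∈ Icc (0 : ℝ) 1, V x = ∫ t in (1 / 2 : ℝ)..x, G t := fun x hx => by
    rw [← prim_sub hGi hhalf hx]; simp only [hV]; ring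
  have hVhalf : V (1 / 2) = 0 := by simp [hV]
  have hmem : ∀ {x : ℝ}, x ∈ Icc (0 : ℝ) 1 → 1 - x ∈ Icc (0 : ℝ) 1 := fun hx =>
    ⟨by linarith [hx.2], by linarith [hx.1]⟩
  have hVodd : ∀ x ∈ Icc (0 : ℝ) 1, V (1 - x) = -V x := fun x hx => by
    rw [hVint _ (hmem hx), hVint x hx, ← intervalIntegral.integral_symm]
    have := intervalIntegral.integral_comp_sub_left G (1 : ℝ) (a := x) (b := 1 / 2)
    simp only [hGev] at this
    rw [this]; norm_num
  have hV0 : ∫ x in Ioo (0 : ℝ) 1, V x = 0 := by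
    have h1 := integral_Ioo_reflect V
    rw [setIntegral_congr_fun measurableSet_Ioo
      (fun x hx => hVodd x (Ioo_subset_Icc_self hx)), integral_neg] at h1
    linarith
  have hVabs : ∀ x ∈ Ioo (0 : ℝ) 1, V x ^ 2 = V (1 / 2 + |x - 1 / 2|) ^ 2 := fun x hx => by
    rcases abs_cases (x - 1 / 2) with ⟨a, b⟩ | ⟨a, b⟩
    · rw [a]; ring_nf
    · rw [a, show 1 / 2 + -(x - 1 / 2) = 1 - x by ring, hVodd x (Ioo_subset_Icc_self hx), neg_sq]
  have hcheb := integral_sq_mul_le_of_symmetric hh hsym (hVc.pow 2) (by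
    intro x hx y hy hxy
    show V x ^ 2 ≤ V y ^ 2
    rw [hVabs x hx, hVabs y hy]
    have hr : ∀ s ∈ Ioo (0 : ℝ) 1, 1 / 2 + |s - 1 / 2| ∈ Icc (0 : ℝ) 1 := fun s hs => by
      have : |s - 1 / 2| ≤ 1 / 2 := abs_le.2 ⟨by linarith [hs.1], by linarith [hs.2]⟩
      exact ⟨by positivity, by linarith⟩
    refine pow_le_pow_left₀ ?_ (hVmono (hr x hx) (hr y hy) (by linarith)) 2
    rw [← hVhalf]
    exact hVmono hhalf (hr x hx) (by linarith [abs_nonneg (x - 1 / 2)]))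
  change ∫ x in Ioo (0 : ℝ) 1, V x ^ 2 * h x ≤ ∫ x in Ioo (0 : ℝ) 1, V x ^ 2 at hcheb
  have hσ := sigma1_mul_le hh.1 hGL (-prim G (1 / 2))
  change sigma1 h * ((∫ x in Ioo (0 : ℝ) 1, V x ^ 2) - (∫ x in Ioo (0 : ℝ) 1, V x) ^ 2) ≤ _ at hσ
  rw [hV0] at hσ
  -- doubling by symmetry
  have hdouble : ∀ f : ℝ → ℝ, Integrable f ν → Integrable (fun x => f (1 - x)) ν →
      ∫ x in Ioo (0 : ℝ) 1, (f x + f (1 - x)) * h x = 2 * ∫ x in Ioo (0 : ℝ) 1, f x * h x := by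
    intro f hf hf'
    have h1 := integral_Ioo_reflect fun x => f x * h x
    rw [setIntegral_congr_fun measurableSet_Ioo
      (g := fun x => f (1 - x) * h x) (fun x hx => by simp only [← hsym x hx])] at h1
    simp only [add_mul]
    rw [integral_add (hh.1.integrable_mul hf) (hh.1.integrable_mul hf'), h1]; ring
  have hE : ∫ x in Ioo (0 : ℝ) 1, G x ^ 2 * h x = 2 * ∫ x in Ioo (0 : ℝ) 1, g x ^ 2 * h x := by
    simp only [hGsq]
    exact hdouble (fun x => g x ^ 2) hg.integrable_sq hgr.integrable_sq
  set f : ℝ → ℝ := fun x => c + prim g x - (c + prim g (1 / 2)) with hf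
  have hfc : ContinuousOn f (Icc 0 1) :=
    (continuousOn_const_add_prim hg c).sub continuousOn_const
  have hfc' : ContinuousOn (fun x => f (1 - x)) (Icc 0 1) :=
    hfc.comp (continuousOn_const.sub continuousOn_id) fun x hx => hmem hx
  have hfint : ∀ x ∈ Icc (0 : ℝ) 1, f x = ∫ t in (1 / 2 : ℝ)..x, g t := fun x hx => by
    rw [← prim_sub hg.integrable_Ioo hhalf hx]; simp only [hf]; ring
  -- The integral of z from 1/2 to x is (f(x), -f(1 - x)); its norm is at most |∫ ‖z‖| = |V(x)|.
  have hfV : ∀ x ∈ Ioo (0 : ℝ) 1, f x ^ 2 + f (1 - x) ^ 2 ≤ V x ^ 2 := by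
    intro x hx
    have hxc := Ioo_subset_Icc_self hx
    have hzI : IntervalIntegrable z volume (1 / 2) x :=
      ((intervalIntegrable_iff_integrableOn_Ioo_of_le (zero_le_one' ℝ)).2 hzi).mono_set (by
        rw [uIcc_of_le (zero_le_one' ℝ)]; exact uIcc_subset_Icc hhalf hxc)
    have hre : (∫ t in (1 / 2 : ℝ)..x, z t).re = f x := by
      rw [hfint x hxc]
      exact (Complex.reCLM.intervalIntegral_comp_comm hzI).symm
    have him : (∫ t in (1 / 2 : ℝ)..x, z t).im = -f (1 - x) := by
      rw [hfint _ (hmem hxc), ← intervalIntegral.integral_symm]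
      refine (Complex.imCLM.intervalIntegral_comp_comm hzI).symm.trans ?_
      have := intervalIntegral.integral_comp_sub_left g (1 : ℝ) (a := 1 / 2) (b := x)
      refine this.trans ?_
      norm_num
    have hn := intervalIntegral.norm_integral_le_abs_integral_norm (f := z) (μ := volume)
      (a := 1 / 2) (b := x)
    change _ ≤ |∫ t in (1 / 2 : ℝ)..x, G t| at hn
    rw [← hVint x hxc] at hn
    have h2 := pow_le_pow_left₀ (norm_nonneg _) hn 2
    rw [sq_abs, Complex.sq_norm, Complex.normSq_apply, hre, him] at h2
    linarith
  have hfsum : 2 * ∫ x in Ioo (0 : ℝ) 1, f x ^ 2 * h x ≤ ∫ x in Ioo (0 : ℝ) 1, V x ^ 2 * h x := by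
    rw [← hdouble (fun x => f x ^ 2) (integrable_Ioo_of_continuousOn (hfc.pow 2))
      (integrable_Ioo_of_continuousOn (hfc'.pow 2))]
    refine setIntegral_mono_on
      (hh.1.integrable_mul (integrable_Ioo_of_continuousOn ((hfc.pow 2).add (hfc'.pow 2))))
      (hh.1.integrable_mul (integrable_Ioo_of_continuousOn (hVc.pow 2))) measurableSet_Ioo
      fun x hx => mul_le_mul_of_nonneg_right (hfV x hx) (hh.1.pos hx).le
  have hmean : ∫ x in Ioo (0 : ℝ) 1, (c + prim g x) ^ 2 * h x ≤
      ∫ x in Ioo (0 : ℝ) 1, f x ^ 2 * h x := by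
    have hu := continuousOn_const_add_prim hg c
    set a := c + prim g (1 / 2) with ha
    have e : ∀ x, f x ^ 2 * h x = (c + prim g x) ^ 2 * h x - (2 * a) * ((c + prim g x) * h x) +
      a ^ 2 * h x := fun x => by simp only [hf]; ring
    have i1 := hh.1.integrable_mul (integrable_Ioo_of_continuousOn hu)
    have i2 : Integrable (fun x => (c + prim g x) ^ 2 * h x) ν :=
      hh.1.integrable_mul (integrable_Ioo_of_continuousOn (hu.pow 2))
    have i3 : Integrable (fun x => (c + prim g x) ^ 2 * h x -
      (2 * a) * ((c + prim g x) * h x)) ν := i2.sub (i1.const_mul _)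
    simp only [e]
    rw [integral_add i3 (hh.1.integrable.const_mul _), integral_sub i2 (i1.const_mul _),
      integral_const_mul, integral_const_mul, hm, hh.2]
    nlinarith [sq_nonneg a]
  have hσ0 := (sigma1_pos hh.1).le
  have t1 := mul_le_mul_of_nonneg_left hmean hσ0
  have t2 := mul_le_mul_of_nonneg_left hfsum hσ0
  have t3 := mul_le_mul_of_nonneg_left hcheb hσ0
  rw [hE] at hσ
  linarith

theorem theorem1p3 (h : ℝ → ℝ) (hh : IsUnitProfile h) :
    0 < sigma1 h ∧
    mu1 h / sigma1 h ≤ 2 ∧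
    (mu1 h / sigma1 h = 2 ↔ ∃ x₀ ∈ Set.Icc (0 : ℝ) 1, Set.EqOn h (triangle x₀) (Set.Ioo 0 1)) ∧
    ((∀ x ∈ Set.Ioo (0 : ℝ) 1, h x = h (1 - x)) → 1 ≤ mu1 h / sigma1 h) := by
  have hσ := sigma1_pos hh.1
  refine ⟨hσ, ?_, ?_, fun hsym => ?_⟩
  · rw [div_le_iff₀ hσ]
    exact mu1_le_two_mul_sigma1 hh
  · rw [div_eq_iff hσ.ne']
    constructor
    · intro heq
      refine hh.exists_triangle_of_sq_eq fun x hx => ?_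
      by_contra hne
      exact (mu1_lt_two_mul_sigma1 hh hx (lt_of_le_of_ne (hh.sq_le hx) hne)).ne heq
    · rintro ⟨x₀, hx₀, he⟩
      exact le_antisymm (mu1_le_two_mul_sigma1 hh)
        (two_mul_sigma1_le_mu1 hh fun x hx => hh.sq_eq_of_triangle hx₀ he hx)
  · rw [le_div_iff₀ hσ, one_mul]
    exact sigma1_le_mu1_of_symmetric hh hsym
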